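/- Work over $\mathbb C$; algebras are unital and associative. A seminorm $p$ on an algebra is submultiplicative if $p(ab)\le p(a)p(b)$. An Arens–Michael algebra is a complete Hausdorff locally convex algebra whose topology is generated by a family of submultiplicative seminorms. A $\widehat\otimes$-algebra is a complete Hausdorff locally convex algebra with jointly continuous multiplication; $\widehat\otimes$ denotes the completed projective tensor product. A $\widehat\otimes$-bialgebra is a $\widehat\otimes$-algebra $H$ with continuous algebra homomorphisms $\Delta:H\to H\widehat\otimes H$ and $\varepsilon:H\to\mathbb C$ that are coassociative and counital. For such an $H$, an $H$-$\widehat\otimes$-module algebra is a $\widehat\otimes$-algebra $A$ that is a left unital $H$-module with jointly continuous action $H\times A\to A$, such that the product $A\widehat\otimes A\to A$ and the unit map $\mathbb C\to A$ are $H$-module morphisms. The analytic smash product $A\,\widehat{\#}\,H$ is the space $A\widehat\otimes H$ with the multiplication $(\mu_A\otimes\mu_H)(1_A\otimes\tau\otimes 1_H)$, where $\tau:H\widehat\otimes A\to A\widehat\otimes H$ is the composition of $\Delta\otimes 1_A$, of $1_H\otimes(\text{flip})$ and of $(\text{action})\otimes 1_H$, i.e. formally $\tau(h\otimes a)=\sum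 h_{(1)}\cdot a\otimes h_{(2)}$. **Proposition.** Let $H$ be a bialgebra and let $A$ be an $H$-module algebra. Let $\widehat H$ be the completion of $H$ with respect to all submultiplicative seminorms (the Arens–Michael envelope), and let $\widetilde A$ be the completion of $A$ with respect to all submultiplicative seminorms $\|\cdot\|$ that are $H$-stable, i.e. such that for each $h\in H$ there is $C>0$ with $\|h\cdot a\|\le C\|a\|$ for all $a\in A$. (Completions of non-Hausdorff spaces are Hausdorff completions.) Then the comultiplication and the counit of $H$ extend uniquely to a $\widehat\otimes$-bialgebra structure on $\widehat H$. With respect to it, the action of $H$ on $A$ extends to a jointly continuous bilinear map $\widehat H\times\widetilde A\to\widetilde A$ which makes $\widetilde A$ an $\widehat H$-$\widehat\otimes$-module algebra, and this map is the only jointly continuous bilinear map $\widehat H\times\widetilde A\to\widetilde A$ extending the action. Moreover, the analytic smash product $\widetilde A\,\widehat{\#}\,\widehat H$, with unit $1\otimes 1$, is an Arens–Michael algebra. -/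

import Mathlib

open scoped TensorProduct

/-- The uniform structure generated by a set of seminorms. -/
@[reducible] def seminormUniformity {E : Type*} [AddCommGroup E] [Module ℂ E] (S : Set (Seminorm ℂ E)) :
    UniformSpace E :=
  ⨅ p : S, p.1.toSeminormedAddCommGroup.toUniformSpace

/-- A locally convex space: a topological vector space (with its canonical uniform structure)
whose topology is generated by a family of seminorms. -/
class LCSpace (E : Type*) [AddCommGroup E] [Module ℂ E] [UniformSpace E] : Prop extends
    IsUniformAddGroup E, ContinuousSMul ℂ E, PolynormableSpace ℂ E

/-- A complete Hausdorff locally convex space. -/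
class CompleteLCSpace (E : Type*) [AddCommGroup E] [Module ℂ E] [UniformSpace E] : Prop extends
    LCSpace E, CompleteSpace E, T2Space E

/-- The scalar action on a locally convex space is uniformly continuous in each variable. -/
instance (priority := 100) LCSpace.uniformContinuousConstSMul (E : Type*) [AddCommGroup E]
    [Module ℂ E] [UniformSpace E] [LCSpace E] : UniformContinuousConstSMul ℂ E :=
  uniformContinuousConstSMul_of_continuousConstSMul ℂ E

section LC

variable {E : Type*} [AddCommGroup E] [Module ℂ E]

theorem seminormUniformity_isUniformAddGroup (S : Set (Seminorm ℂ E)) :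
    @IsUniformAddGroup E (seminormUniformity S) _ :=
  isUniformAddGroup_iInf fun p =>
    @SeminormedAddCommGroup.to_isUniformAddGroup E p.1.toSeminormedAddCommGroup

theorem polynormable_of_seminorm (p : Seminorm ℂ E) :
    @PolynormableSpace ℂ E _ _ _
      p.toSeminormedAddCommGroup.toUniformSpace.toTopologicalSpace := by
  let := p.toSeminormedAddCommGroup
  let : NormedSpace ℂ E := ⟨fun c x => (map_smul_eq_mul p c x).le⟩
  exact (norm_withSeminorms ℂ E).toPolynormableSpace

theorem lcSpace_seminormUniformity (S : Set (Seminorm ℂ E)) :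
    @LCSpace E _ _ (seminormUniformity S) := by
  let : UniformSpace E := seminormUniformity S
  have : IsUniformAddGroup E := seminormUniformity_isUniformAddGroup S
  have : PolynormableSpace ℂ E := by
    rw [UniformSpace.toTopologicalSpace_iInf]
    refine PolynormableSpace.iInf fun p => ?_
    exact polynormable_of_seminorm p.1
  have : ContinuousSMul ℂ E := (PolynormableSpace.withSeminorms ℂ E).continuousSMul
  exact {}

theorem continuous_of_mem_seminormUniformity {S : Set (Seminorm ℂ E)} {p : Seminorm ℂ E}
    (hp : p ∈ S) : @Continuous E ℝ (seminormUniformity S).toTopologicalSpace _ p := by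
  unfold seminormUniformity
  rw [UniformSpace.toTopologicalSpace_iInf]
  exact continuous_iInf_dom (i := (⟨p, hp⟩ : S))
    (@continuous_norm _ p.toSeminormedAddCommGroup.toSeminormedAddGroup)

/-- To check continuity into a space with topology generated by `S`, it suffices to check
that `p ∘ f` is continuous for all `p ∈ S`. -/
theorem continuous_rng_seminormUniformity {S : Set (Seminorm ℂ E)} {X : Type*} [AddCommGroup X]
    [Module ℂ X] [UniformSpace X] [LCSpace X] (f : X →ₗ[ℂ] E)
    (hf : ∀ p ∈ S, Continuous fun x => p (f x)) :
    @Continuous X E _ (seminormUniformity S).toTopologicalSpace f := by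
  unfold seminormUniformity
  rw [UniformSpace.toTopologicalSpace_iInf]
  refine continuous_iInf_rng.2 fun p => ?_
  let := p.1.toSeminormedAddCommGroup
  let : NormedSpace ℂ E := ⟨fun c x => (map_smul_eq_mul p.1 c x).le⟩
  refine continuous_of_continuousAt_zero f ?_
  rw [ContinuousAt, map_zero, tendsto_zero_iff_norm_tendsto_zero]
  have := (hf p.1 p.2).tendsto 0
  simp only [map_zero] at this
  exact this

variable [UniformSpace E] [LCSpace E]

theorem exists_seminorm_ball_subset {U : Set E} (hU : U ∈ nhds (0 : E)) :
    ∃ r : Seminorm ℂ E, Continuous r ∧ r.ball 0 1 ⊆ U := by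
  obtain ⟨⟨s, ε⟩, hε, hs⟩ :=
    ((PolynormableSpace.withSeminorms ℂ E).hasBasis_zero_ball).mem_iff.1 hU
  simp only at hε hs
  have hc : Continuous ⇑(s.sup fun p : {p : Seminorm ℂ E // Continuous p} => p.1) :=
    Seminorm.continuous_finsetSup fun i _ => i.2
  refine ⟨Real.toNNReal ε⁻¹ •
    s.sup (fun p : {p : Seminorm ℂ E // Continuous p} => p.1), ?_, fun x hx => hs ?_⟩
  · exact Continuous.const_smul hc (Real.toNNReal ε⁻¹)
  · rw [Seminorm.mem_ball_zero] at hx ⊢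
    have : ε⁻¹ * (s.sup fun p : {p : Seminorm ℂ E // Continuous p} => p.1) x < 1 := by
      have h := hx
      rw [smul_apply, NNReal.smul_def, Real.coe_toNNReal _ (by positivity)] at h
      exact h
    rwa [inv_mul_lt_iff₀ hε, mul_one] at this

variable {F : Type*} [AddCommGroup F] [Module ℂ F] [UniformSpace F] [LCSpace F]
variable {G : Type*} [AddCommGroup G] [Module ℂ G] [UniformSpace G]

theorem exists_bound_of_continuous (B : E →ₗ[ℂ] F →ₗ[ℂ] G)
    (hB : Continuous fun z : E × F => B z.1 z.2) (P : Seminorm ℂ G) (hP : Continuous P) :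
    ∃ r : Seminorm ℂ E, ∃ s : Seminorm ℂ F, Continuous r ∧ Continuous s ∧
      ∀ x y, P (B x y) ≤ r x * s y := by
  have h0 : {z : E × F | P (B z.1 z.2) < 1} ∈ nhds ((0 : E), (0 : F)) := by
    refine (isOpen_lt (hP.comp hB) continuous_const).mem_nhds ?_
    simp
  rw [nhds_prod_eq, Filter.mem_prod_iff] at h0
  obtain ⟨U, hU, V, hV, hUV⟩ := h0
  obtain ⟨r, hr, hrU⟩ := exists_seminorm_ball_subset hU
  obtain ⟨s, hs, hsV⟩ := exists_seminorm_ball_subset hV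
  refine ⟨r, s, hr, hs, fun x y => ?_⟩
  have key : ∀ ε : ℝ, 0 < ε → P (B x y) ≤ (r x + ε) * (s y + ε) := by
    intro ε hε
    have ha : 0 < r x + ε := add_pos_of_nonneg_of_pos (apply_nonneg r x) hε
    have hb : 0 < s y + ε := add_pos_of_nonneg_of_pos (apply_nonneg s y) hε
    have hx : ((r x + ε : ℝ) : ℂ)⁻¹ • x ∈ U := by
      refine hrU ?_
      rw [Seminorm.mem_ball_zero, map_smul_eq_mul, norm_inv, Complex.norm_real,
        Real.norm_of_nonneg ha.le, inv_mul_lt_iff₀ ha]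
      linarith
    have hy : ((s y + ε : ℝ) : ℂ)⁻¹ • y ∈ V := by
      refine hsV ?_
      rw [Seminorm.mem_ball_zero, map_smul_eq_mul, norm_inv, Complex.norm_real,
        Real.norm_of_nonneg hb.le, inv_mul_lt_iff₀ hb]
      linarith
    have h1 : P (B (((r x + ε : ℝ) : ℂ)⁻¹ • x) (((s y + ε : ℝ) : ℂ)⁻¹ • y)) < 1 :=
      hUV (Set.mk_mem_prod hx hy)
    rw [LinearMap.map_smul, LinearMap.map_smul, LinearMap.smul_apply, map_smul_eq_mul, map_smul_eq_mul, norm_inv,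
      norm_inv, Complex.norm_real, Complex.norm_real, Real.norm_of_nonneg ha.le,
      Real.norm_of_nonneg hb.le, inv_mul_lt_iff₀ hb, inv_mul_lt_iff₀ ha] at h1
    linarith
  have hlim : Filter.Tendsto (fun ε : ℝ => (r x + ε) * (s y + ε)) (nhdsWithin 0 (Set.Ioi 0))
      (nhds (r x * s y)) := by
    have : Continuous fun ε : ℝ => (r x + ε) * (s y + ε) := by fun_prop
    have h2 := (this.tendsto 0).mono_left (nhdsWithin_le_nhds (s := Set.Ioi (0 : ℝ)))
    simpa using h2
  exact ge_of_tendsto hlim (by filter_upwards [self_mem_nhdsWithin] with ε hε using key ε hε)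

variable [LCSpace G]

theorem continuousAt_of_bounds {X : Type*} [TopologicalSpace X] (f : X → G) (x : X)
    (hx : f x = 0) (h : ∀ P : Seminorm ℂ G, Continuous P → ∃ g : X → ℝ, ContinuousAt g x ∧
      g x = 0 ∧ ∀ z, P (f z) ≤ g z) : ContinuousAt f x := by
  rw [ContinuousAt, hx, (PolynormableSpace.withSeminorms ℂ G).tendsto_nhds]
  intro P ε hε
  obtain ⟨g, hg, hgx, hle⟩ := h P.1 P.2
  have : ∀ᶠ z in nhds x, g z < ε := hg.eventually_lt_const (by rwa [hgx])
  filter_upwards [this] with z hz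
  rw [sub_zero]
  exact (hle z).trans_lt hz

theorem continuous_of_bounds (B : E →ₗ[ℂ] F →ₗ[ℂ] G)
    (hB : ∀ P : Seminorm ℂ G, Continuous P → ∃ r : Seminorm ℂ E, ∃ s : Seminorm ℂ F,
      Continuous r ∧ Continuous s ∧ ∀ x y, P (B x y) ≤ r x * s y) :
    Continuous fun z : E × F => B z.1 z.2 := by
  refine continuous_of_continuousAt_zero₂
    (G := E) (H := F) (M := G)
    (AddMonoidHom.mk' (fun x => (B x).toAddMonoidHom) fun x y => by ext z; simp) ?_ ?_ ?_
  · refine continuousAt_of_bounds _ _ (by simp) fun P hP => ?_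
    obtain ⟨r, s, hr, hs, h⟩ := hB P hP
    exact ⟨fun z => r z.1 * s z.2,
      ((hr.comp continuous_fst).mul (hs.comp continuous_snd)).continuousAt, by simp,
      fun z => h z.1 z.2⟩
  · intro x
    refine continuousAt_of_bounds _ _ (map_zero (B x)) fun P hP => ?_
    obtain ⟨r, s, hr, hs, h⟩ := hB P hP
    exact ⟨fun y => r x * s y, (continuous_const.mul hs).continuousAt, by simp, fun y => h x y⟩
  · intro y
    refine continuousAt_of_bounds _ _ (map_zero (B.flip y)) fun P hP => ?_
    obtain ⟨r, s, hr, hs, h⟩ := hB P hP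
    exact ⟨fun x => r x * s y, (hr.mul continuous_const).continuousAt, by simp, fun x => h x y⟩

open UniformSpace in
/-- The extension of a continuous seminorm to the completion. -/
noncomputable def completionSeminorm (p : Seminorm ℂ E) (hp : Continuous p) :
    Seminorm ℂ (Completion E) :=
  have hu : UniformContinuous p := p.uniformContinuous_of_continuousAt_zero hp.continuousAt
  Seminorm.of (Completion.extension p)
    (fun x y => by
      induction x, y using Completion.induction_on₂ with
      | hp =>
        exact isClosed_le (Completion.continuous_extension.comp continuous_add)
          ((Completion.continuous_extension.comp continuous_fst).add
            (Completion.continuous_extension.comp continuous_snd))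
      | ih x y =>
        rw [← Completion.coe_add, Completion.extension_coe hu, Completion.extension_coe hu,
          Completion.extension_coe hu]
        exact map_add_le_add p x y)
    (fun c x => by
      induction x using Completion.induction_on with
      | hp =>
        exact isClosed_eq (Completion.continuous_extension.comp (continuous_const_smul c))
          (continuous_const.mul Completion.continuous_extension)
      | ih x =>
        rw [← Completion.coe_smul, Completion.extension_coe hu, Completion.extension_coe hu]
        exact map_smul_eq_mul p c x)

open UniformSpace in
theorem completionSeminorm_coe (p : Seminorm ℂ E) (hp : Continuous p) (x : E) :
    completionSeminorm p hp (x : Completion E) = p x :=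
  Completion.extension_coe (p.uniformContinuous_of_continuousAt_zero hp.continuousAt) x

open UniformSpace in
theorem continuous_completionSeminorm (p : Seminorm ℂ E) (hp : Continuous p) :
    Continuous (completionSeminorm p hp) :=
  Completion.continuous_extension

open UniformSpace in
instance completeLCSpace_completion : CompleteLCSpace (Completion E) := by
  have : PolynormableSpace ℂ (Completion E) := by
    refine ⟨SeminormFamily.withSeminorms_of_hasBasis _ ⟨fun U => ⟨fun hU => ?_, ?_⟩⟩⟩
    · obtain ⟨V, ⟨hV, hVc⟩, hVU⟩ := (closed_nhds_basis (0 : Completion E)).mem_iff.1 hU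
      have h1 : ((↑) : E → Completion E) ⁻¹' V ∈ nhds (0 : E) :=
        (Completion.continuous_coe E).continuousAt.preimage_mem_nhds
          (by rwa [Completion.coe_zero])
      obtain ⟨r, hr, hrV⟩ := exists_seminorm_ball_subset h1
      refine ⟨_, SeminormFamily.basisSets_singleton_mem _
        ⟨completionSeminorm r hr, continuous_completionSeminorm r hr⟩ one_pos, ?_⟩
      refine Set.Subset.trans ?_ hVU
      intro x hx
      simp only [id, Seminorm.mem_ball_zero] at hx
      have ho : IsOpen {y : Completion E | completionSeminorm r hr y < 1} :=
        isOpen_lt (continuous_completionSeminorm r hr) continuous_const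
      have hd : x ∈ closure ({y : Completion E | completionSeminorm r hr y < 1} ∩
          Set.range ((↑) : E → Completion E)) :=
        (Completion.denseRange_coe).open_subset_closure_inter ho hx
      refine closure_minimal ?_ hVc hd
      rintro _ ⟨hy, y, rfl⟩
      refine hrV ?_
      rw [Seminorm.mem_ball_zero]
      simpa [completionSeminorm_coe] using hy
    · rintro ⟨V, hV, hVU⟩
      refine Filter.mem_of_superset ?_ hVU
      obtain ⟨s, ε, hε, rfl⟩ := (SeminormFamily.basisSets_iff _).1 hV
      have hc : Continuous
          ⇑(s.sup fun p : {p : Seminorm ℂ (Completion E) // Continuous p} => p.1) :=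
        Seminorm.continuous_finsetSup fun i _ => i.2
      have : {y | (s.sup fun p : {p : Seminorm ℂ (Completion E) // Continuous p} => p.1) y < ε} ∈
          nhds (0 : Completion E) :=
        (isOpen_lt hc continuous_const).mem_nhds (by simpa using hε)
      simpa [Seminorm.ball_zero_eq] using this
  have : ContinuousSMul ℂ (Completion E) :=
    (PolynormableSpace.withSeminorms ℂ (Completion E)).continuousSMul
  exact {}

instance completeLCSpace_complex : CompleteLCSpace ℂ where
  __ := (inferInstance : IsUniformAddGroup ℂ)
  __ := (inferInstance : ContinuousSMul ℂ ℂ)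
  __ := (inferInstance : PolynormableSpace ℂ ℂ)
  __ := (inferInstance : CompleteSpace ℂ)
  __ := (inferInstance : T2Space ℂ)

end LC

/-! ### Completions of algebras with respect to submultiplicative seminorms -/

/-- A seminorm on an algebra is submultiplicative if `p (a * b) ≤ p a * p b`. -/
def IsSubmultiplicative {A : Type*} [Ring A] [Algebra ℂ A] (p : Seminorm ℂ A) : Prop :=
  ∀ a b : A, p (a * b) ≤ p a * p b

/-- A copy of the algebra `A`, endowed with the topology generated by all submultiplicative
seminorms on `A` with the property `P`. -/
def SeminormAlgebra (A : Type*) [Ring A] [Algebra ℂ A] (_P : Seminorm ℂ A → Prop) : Type _ := A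

namespace SeminormAlgebra

variable (A : Type*) [Ring A] [Algebra ℂ A] (P : Seminorm ℂ A → Prop)

instance : Ring (SeminormAlgebra A P) := inferInstanceAs (Ring A)

instance : Algebra ℂ (SeminormAlgebra A P) := inferInstanceAs (Algebra ℂ A)

instance : UniformSpace (SeminormAlgebra A P) :=
  seminormUniformity (E := A) {p | IsSubmultiplicative p ∧ P p}

instance : LCSpace (SeminormAlgebra A P) :=
  lcSpace_seminormUniformity (E := A) {p | IsSubmultiplicative p ∧ P p}

/-- The identity map from `A` to its topologized copy. -/
def of : A →ₐ[ℂ] SeminormAlgebra A P := AlgHom.id ℂ A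

instance : IsTopologicalRing (SeminormAlgebra A P) := by
  have : ContinuousMul (SeminormAlgebra A P) := by
    refine ⟨?_⟩
    change @Continuous (A × A) A
      (@instTopologicalSpaceProd A A
        (seminormUniformity {p : Seminorm ℂ A | IsSubmultiplicative p ∧ P p}).toTopologicalSpace
        (seminormUniformity {p : Seminorm ℂ A | IsSubmultiplicative p ∧ P p}).toTopologicalSpace)
      (seminormUniformity {p : Seminorm ℂ A | IsSubmultiplicative p ∧ P p}).toTopologicalSpace
      (fun z => z.1 * z.2)
    unfold seminormUniformity
    rw [UniformSpace.toTopologicalSpace_iInf]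
    refine (@continuousMul_iInf A _ _ _ fun p => ?_).continuous_mul
    let : SeminormedAddCommGroup A := p.1.toSeminormedAddCommGroup
    let : SeminormedRing A := { p.1.toSeminormedAddCommGroup, (inferInstance : Ring A) with
      norm_mul_le := p.2.1 }
    exact (inferInstance : ContinuousMul A)
  exact {}

end SeminormAlgebra

/-- The Arens-Michael envelope of an algebra `A`: the completion of `A` with respect to the
family of all submultiplicative seminorms. -/
abbrev AMEnvelope (A : Type*) [Ring A] [Algebra ℂ A] : Type _ :=
  UniformSpace.Completion (SeminormAlgebra A fun _ => True)

/-- The canonical homomorphism of an algebra to its Arens-Michael envelope. -/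
noncomputable def AMEnvelope.ι (A : Type*) [Ring A] [Algebra ℂ A] : A →ₐ[ℂ] AMEnvelope A where
  __ := UniformSpace.Completion.coeRingHom.comp (SeminormAlgebra.of A fun _ => True).toRingHom
  commutes' _ := rfl

/-- A seminorm on a left `B`-module is `B`-stable if every `b : B` acts boundedly. -/
def IsStableSeminorm (B : Type*) {E : Type*} [Ring B] [AddCommGroup E] [Module ℂ E] [Module B E]
    (p : Seminorm ℂ E) : Prop :=
  ∀ b : B, ∃ C : ℝ, 0 < C ∧ ∀ x : E, p (b • x) ≤ C * p x

/-- The `H`-completion of `A`: the completion of `A` with respect to the family of all `H`-stable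
submultiplicative seminorms. -/
abbrev HCompletion (H A : Type*) [Ring H] [Ring A] [Algebra ℂ A] [Module H A] : Type _ :=
  UniformSpace.Completion (SeminormAlgebra A (IsStableSeminorm H))

/-- The canonical homomorphism of `A` to its `H`-completion. -/
noncomputable def HCompletion.ι (H A : Type*) [Ring H] [Ring A] [Algebra ℂ A] [Module H A] :
    A →ₐ[ℂ] HCompletion H A where
  __ := UniformSpace.Completion.coeRingHom.comp (SeminormAlgebra.of A (IsStableSeminorm H)).toRingHom
  commutes' _ := rfl


/-! ### The completed projective tensor product -/

/-- A copy of the algebraic tensor product `E ⊗ F`, endowed with the projective topology. -/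
def ProjTensor (E F : Type*) [AddCommGroup E] [Module ℂ E] [AddCommGroup F] [Module ℂ F] :
    Type _ := E ⊗[ℂ] F

section ProjTensor

variable (E F : Type*) [AddCommGroup E] [Module ℂ E] [AddCommGroup F] [Module ℂ F]

noncomputable instance : AddCommGroup (ProjTensor E F) := inferInstanceAs (AddCommGroup (E ⊗[ℂ] F))

noncomputable instance : Module ℂ (ProjTensor E F) := inferInstanceAs (Module ℂ (E ⊗[ℂ] F))

variable [UniformSpace E] [UniformSpace F]

/-- The seminorms `p` on `E ⊗ F` dominated on elementary tensors by some `r ⊗ s`, where `r` and `s`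
are continuous seminorms on `E` and `F`. They generate the projective tensor product topology:
their unit balls are the absolutely convex absorbing sets containing some
`U ⊗ V = {u ⊗ v | u ∈ U, v ∈ V}`, with `U` and `V` neighbourhoods of `0`. -/
def projSeminorms : Set (Seminorm ℂ (E ⊗[ℂ] F)) :=
  {p | ∃ (r : Seminorm ℂ E) (s : Seminorm ℂ F), Continuous r ∧ Continuous s ∧
    ∀ x y, p (x ⊗ₜ[ℂ] y) ≤ r x * s y}

noncomputable instance : UniformSpace (ProjTensor E F) := seminormUniformity (projSeminorms E F)

instance : LCSpace (ProjTensor E F) := lcSpace_seminormUniformity (projSeminorms E F)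

variable {E F} in
theorem mem_projSeminorms_of_continuous (P : Seminorm ℂ (ProjTensor E F)) (hP : Continuous P) :
    ∃ (r : Seminorm ℂ E) (s : Seminorm ℂ F), Continuous r ∧ Continuous s ∧
      ∀ x y, P (x ⊗ₜ[ℂ] y : E ⊗[ℂ] F) ≤ r x * s y := by
  have h0 : (0 : Seminorm ℂ (E ⊗[ℂ] F)) ∈ projSeminorms E F :=
    ⟨0, 0, continuous_const, continuous_const, fun x y => by simp⟩
  have : Nonempty (projSeminorms E F) := ⟨⟨0, h0⟩⟩
  have hw : WithSeminorms (E := ProjTensor E F) (fun p : projSeminorms E F => p.1) :=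
    (SeminormFamily.withSeminorms_iff_uniformSpace_eq_iInf (E := ProjTensor E F) _).2 rfl
  obtain ⟨t, C, -, hC⟩ := Seminorm.bound_of_continuous hw P hP
  have hsup : ∀ t : Finset (projSeminorms E F),
      (t.sup fun p : projSeminorms E F => p.1) ∈ projSeminorms E F := by
    classical
    intro t
    induction t using Finset.induction_on with
    | empty => simpa [Seminorm.bot_eq_zero] using h0
    | insert p t hpt ih =>
      rw [Finset.sup_insert]
      obtain ⟨r₁, s₁, hr₁, hs₁, h₁⟩ := p.2
      obtain ⟨r₂, s₂, hr₂, hs₂, h₂⟩ := ih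
      refine ⟨r₁ + r₂, s₁ + s₂, hr₁.add hr₂, hs₁.add hs₂, fun x y => ?_⟩
      have a₁ := apply_nonneg r₁ x
      have a₂ := apply_nonneg r₂ x
      have b₁ := apply_nonneg s₁ y
      have b₂ := apply_nonneg s₂ y
      rw [Seminorm.sup_apply, add_apply, add_apply]
      refine sup_le ((h₁ x y).trans ?_) ((h₂ x y).trans ?_)
      · nlinarith [mul_nonneg a₁ b₂, mul_nonneg a₂ b₁, mul_nonneg a₂ b₂]
      · nlinarith [mul_nonneg a₁ b₂, mul_nonneg a₂ b₁, mul_nonneg a₁ b₁]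
  obtain ⟨r, s, hr, hs, h⟩ := hsup t
  refine ⟨C • r, s, Continuous.const_smul hr C, hs, fun x y => (hC _).trans ?_⟩
  have := mul_le_mul_of_nonneg_left (h x y) C.coe_nonneg
  change (C : ℝ) * _ ≤ (C : ℝ) * r x * s y
  rw [mul_assoc]
  exact this

/-- The completed projective tensor product of locally convex spaces. -/
abbrev CTensor : Type _ := UniformSpace.Completion (ProjTensor E F)

end ProjTensor

namespace CTensor

section ProjSeminorm

variable {E F : Type*} [AddCommGroup E] [Module ℂ E] [AddCommGroup F] [Module ℂ F]

/-- The projective tensor product of two seminorms. -/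
noncomputable def projSeminorm (r : Seminorm ℂ E) (s : Seminorm ℂ F) : Seminorm ℂ (E ⊗[ℂ] F) :=
  sSup {p | ∀ x y, p (x ⊗ₜ[ℂ] y) ≤ r x * s y}

theorem bddAbove_projSeminorm (r : Seminorm ℂ E) (s : Seminorm ℂ F) :
    BddAbove {p : Seminorm ℂ (E ⊗[ℂ] F) | ∀ x y, p (x ⊗ₜ[ℂ] y) ≤ r x * s y} := by
  rw [Seminorm.bddAbove_iff]
  have : ∀ z : E ⊗[ℂ] F, ∃ C : ℝ, ∀ p : Seminorm ℂ (E ⊗[ℂ] F),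
      (∀ x y, p (x ⊗ₜ[ℂ] y) ≤ r x * s y) → p z ≤ C := by
    intro z
    induction z using TensorProduct.induction_on with
    | zero => exact ⟨0, fun p _ => (map_zero p).le⟩
    | tmul x y => exact ⟨_, fun p hp => hp x y⟩
    | add z w hz hw =>
      obtain ⟨C, hC⟩ := hz
      obtain ⟨D, hD⟩ := hw
      exact ⟨C + D, fun p hp => (map_add_le_add p z w).trans (add_le_add (hC p hp) (hD p hp))⟩
  choose C hC using this
  refine ⟨C, ?_⟩
  rintro _ ⟨p, hp, rfl⟩ z
  exact hC z p hp

theorem projSeminorm_tmul_le (r : Seminorm ℂ E) (s : Seminorm ℂ F) (x : E) (y : F) :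
    projSeminorm r s (x ⊗ₜ[ℂ] y) ≤ r x * s y := by
  rw [projSeminorm, Seminorm.sSup_apply (bddAbove_projSeminorm r s)]
  exact Real.iSup_le (fun p => p.2 x y) (mul_nonneg (apply_nonneg r x) (apply_nonneg s y))

theorem le_projSeminorm (r : Seminorm ℂ E) (s : Seminorm ℂ F) (p : Seminorm ℂ (E ⊗[ℂ] F))
    (c : ℝ) (hc : 0 ≤ c) (hp : ∀ x y, p (x ⊗ₜ[ℂ] y) ≤ c * (r x * s y)) (z : E ⊗[ℂ] F) :
    p z ≤ c * projSeminorm r s z := by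
  rcases hc.eq_or_lt with rfl | hc
  · have : p z = 0 := by
      induction z using TensorProduct.induction_on with
      | zero => exact map_zero p
      | tmul x y => exact le_antisymm (by simpa using hp x y) (apply_nonneg _ _)
      | add z w hz hw =>
        exact le_antisymm ((map_add_le_add p z w).trans (by simp [hz, hw])) (apply_nonneg _ _)
    simp [this]
  · have h : (Real.toNNReal c⁻¹ • p) ≤ projSeminorm r s := by
      refine le_csSup (bddAbove_projSeminorm r s) fun x y => ?_
      rw [smul_apply, NNReal.smul_def, Real.coe_toNNReal _ (by positivity), smul_eq_mul,
        inv_mul_le_iff₀ hc]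
      exact hp x y
    have h' := h z
    rwa [smul_apply, NNReal.smul_def, Real.coe_toNNReal _ (by positivity), smul_eq_mul,
      inv_mul_le_iff₀ hc] at h'

end ProjSeminorm

section Basic

variable {E F G : Type*}
  [AddCommGroup E] [Module ℂ E] [UniformSpace E]
  [AddCommGroup F] [Module ℂ F] [UniformSpace F]
  [AddCommGroup G] [Module ℂ G] [UniformSpace G]

/-- The canonical map from the algebraic to the completed tensor product. -/
noncomputable def ofTensor : E ⊗[ℂ] F →ₗ[ℂ] CTensor E F where
  toFun x := UniformSpace.Completion.coe' (α := ProjTensor E F) x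
  map_add' x y := UniformSpace.Completion.coe_add (α := ProjTensor E F) x y
  map_smul' c x := UniformSpace.Completion.coe_smul (X := ProjTensor E F) c x

/-- The elementary tensor `x ⊗ y` in the completed tensor product. -/
noncomputable def tmul : E →ₗ[ℂ] F →ₗ[ℂ] CTensor E F :=
  (TensorProduct.mk ℂ E F).compr₂ ofTensor

theorem denseRange_ofTensor : DenseRange (ofTensor : E ⊗[ℂ] F → CTensor E F) :=
  UniformSpace.Completion.denseRange_coe (α := ProjTensor E F)

/-- Continuous maps on the completed tensor product are determined by elementary tensors. -/
theorem ext {f g : CTensor E F →L[ℂ] G} [T2Space G] (h : ∀ x y, f (tmul x y) = g (tmul x y)) :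
    f = g := by
  have h' : f.toLinearMap ∘ₗ ofTensor = g.toLinearMap ∘ₗ ofTensor := TensorProduct.ext' h
  ext z
  exact congrFun (denseRange_ofTensor.equalizer f.continuous g.continuous
    (funext fun t => LinearMap.congr_fun h' t)) z

theorem exists_bound_tmul (P : Seminorm ℂ (CTensor E F)) (hP : Continuous P) :
    ∃ (r : Seminorm ℂ E) (s : Seminorm ℂ F), Continuous r ∧ Continuous s ∧
      ∀ x y, P (tmul x y) ≤ r x * s y :=
  mem_projSeminorms_of_continuous (P.comp (ofTensor : E ⊗[ℂ] F →ₗ[ℂ] CTensor E F))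
    (hP.comp (UniformSpace.Completion.continuous_coe (ProjTensor E F)))

theorem continuous_projSeminorm (r : Seminorm ℂ E) (s : Seminorm ℂ F) (hr : Continuous r)
    (hs : Continuous s) : Continuous (X := ProjTensor E F) (projSeminorm r s) :=
  continuous_of_mem_seminormUniformity (S := projSeminorms E F)
    ⟨r, s, hr, hs, projSeminorm_tmul_le r s⟩

variable [LCSpace E] [LCSpace F]

theorem continuous_tmul : Continuous fun z : E × F => tmul z.1 z.2 :=
  continuous_of_bounds _ exists_bound_tmul

variable [CompleteLCSpace G]

/-- The continuous linear map on the completed tensor product induced by a jointly continuous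
bilinear map. -/
noncomputable def lift (B : E →ₗ[ℂ] F →ₗ[ℂ] G) (hB : Continuous fun z : E × F => B z.1 z.2) :
    CTensor E F →L[ℂ] G :=
  ContinuousLinearMap.fromCompletion (α := ProjTensor E F)
    { toLinearMap := (TensorProduct.lift B : E ⊗[ℂ] F →ₗ[ℂ] G)
      cont := by
        let f : ProjTensor E F →ₗ[ℂ] G := (TensorProduct.lift B : E ⊗[ℂ] F →ₗ[ℂ] G)
        change Continuous f
        refine continuous_of_continuousAt_zero f ?_
        refine continuousAt_of_bounds (X := ProjTensor E F) _ _ (map_zero _) fun P hP => ?_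
        have hc : Continuous (P.comp f) :=
          continuous_of_mem_seminormUniformity
            (S := projSeminorms E F) (exists_bound_of_continuous B hB P hP)
        exact ⟨_, hc.continuousAt, map_zero _, fun z => le_rfl⟩ }

@[simp]
theorem lift_tmul (B : E →ₗ[ℂ] F →ₗ[ℂ] G) (hB : Continuous fun z : E × F => B z.1 z.2)
    (x : E) (y : F) : lift B hB (tmul x y) = B x y :=
  (ContinuousLinearMap.fromCompletion_apply_coe (α := ProjTensor E F) _
    (x ⊗ₜ[ℂ] y : E ⊗[ℂ] F)).trans (TensorProduct.lift.tmul x y)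

end Basic

section Assoc

variable {E F G K : Type*}
  [AddCommGroup E] [Module ℂ E] [UniformSpace E]
  [AddCommGroup F] [Module ℂ F] [UniformSpace F]
  [AddCommGroup G] [Module ℂ G] [UniformSpace G]
  [AddCommGroup K] [Module ℂ K] [UniformSpace K]

theorem assoc_bound (P : Seminorm ℂ (CTensor E (CTensor F G))) (hP : Continuous P) :
    ∃ (r : Seminorm ℂ E) (s : Seminorm ℂ F) (t : Seminorm ℂ G),
      Continuous r ∧ Continuous s ∧ Continuous t ∧
      ∀ x y z, P (tmul x (tmul y z)) ≤ t z * (r x * s y) := by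
  obtain ⟨r, q, hr, hq, h⟩ := exists_bound_tmul P hP
  obtain ⟨s, t, hs, ht, h'⟩ := exists_bound_tmul q hq
  refine ⟨r, s, t, hr, hs, ht, fun x y z => (h x _).trans ?_⟩
  refine (mul_le_mul_of_nonneg_left (h' y z) (apply_nonneg r x)).trans (le_of_eq ?_)
  ring

variable [LCSpace E] [LCSpace F] [LCSpace G] [LCSpace K]

/-- For fixed `z`, the map `x ⊗ y ↦ x ⊗ (y ⊗ z)`. -/
noncomputable def assocSlice (z : G) : CTensor E F →L[ℂ] CTensor E (CTensor F G) :=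
  lift (LinearMap.compl₂ tmul ((tmul : F →ₗ[ℂ] G →ₗ[ℂ] CTensor F G).flip z)) <|
    continuous_tmul.comp (continuous_fst.prodMk
      ((continuous_tmul.comp (continuous_id.prodMk continuous_const)).comp continuous_snd))

theorem assocSlice_tmul (x : E) (y : F) (z : G) :
    assocSlice z (tmul x y) = tmul x (tmul y z) :=
  lift_tmul _ _ x y

/-- The bilinear map `(x ⊗ y, z) ↦ x ⊗ (y ⊗ z)`. -/
noncomputable def assocAux : CTensor E F →ₗ[ℂ] G →ₗ[ℂ] CTensor E (CTensor F G) :=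
  LinearMap.mk₂ ℂ (fun w z => assocSlice z w)
    (fun w w' z => map_add _ _ _) (fun c w z => map_smul _ _ _)
    (fun w z z' => by
      have : (assocSlice (z + z') : CTensor E F →L[ℂ] _) = assocSlice z + assocSlice z' :=
        ext fun x y => by simp [assocSlice_tmul]
      exact congrArg (fun f => f w) this)
    (fun c w z => by
      have : (assocSlice (c • z) : CTensor E F →L[ℂ] _) = c • assocSlice z :=
        ext fun x y => by simp [assocSlice_tmul]
      exact congrArg (fun f => f w) this)

theorem continuous_assocAux :
    Continuous fun w : CTensor E F × G => assocAux w.1 w.2 := by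
  refine continuous_of_bounds _ fun P hP => ?_
  obtain ⟨r, s, t, hr, hs, ht, h⟩ := assoc_bound P hP
  refine ⟨completionSeminorm (E := ProjTensor E F) (projSeminorm r s)
    (continuous_projSeminorm r s hr hs), t, continuous_completionSeminorm _ _, ht, fun w z => ?_⟩
  refine denseRange_ofTensor.induction_on (p := fun w => P (assocAux w z) ≤
    completionSeminorm (E := ProjTensor E F) (projSeminorm r s)
    (continuous_projSeminorm r s hr hs) w * t z) w ?_ fun u => ?_
  · exact isClosed_le (hP.comp (assocSlice z).continuous)
      ((continuous_completionSeminorm _ _).mul continuous_const)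
  · have := le_projSeminorm r s (P.comp ((assocSlice z).toLinearMap ∘ₗ ofTensor)) (t z)
      (apply_nonneg t z) (fun x y => by
        refine le_trans (le_of_eq ?_) (h x y z)
        exact congrArg P (assocSlice_tmul x y z)) u
    rw [mul_comm]
    refine this.trans (le_of_eq (congrArg _ ?_))
    exact (completionSeminorm_coe (E := ProjTensor E F) _ _ u).symm

/-- The associativity morphism `(E ⊗ F) ⊗ G → E ⊗ (F ⊗ G)`. -/
noncomputable def assoc : CTensor (CTensor E F) G →L[ℂ] CTensor E (CTensor F G) :=
  lift assocAux continuous_assocAux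

@[simp]
theorem assoc_tmul (x : E) (y : F) (z : G) :
    assoc (tmul (tmul x y) z) = tmul x (tmul y z) :=
  (lift_tmul _ _ _ _).trans (assocSlice_tmul x y z)

/-- The flip `E ⊗ F → F ⊗ E`. -/
noncomputable def comm : CTensor E F →L[ℂ] CTensor F E :=
  lift tmul.flip (continuous_tmul.comp continuous_swap)

@[simp]
theorem comm_tmul (x : E) (y : F) : comm (tmul x y) = tmul y x :=
  lift_tmul _ _ _ _

variable {E' F' : Type*}
  [AddCommGroup E'] [Module ℂ E'] [UniformSpace E'] [LCSpace E']
  [AddCommGroup F'] [Module ℂ F'] [UniformSpace F'] [LCSpace F']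

/-- The tensor product of two continuous linear maps. -/
noncomputable def map (f : E →L[ℂ] E') (g : F →L[ℂ] F') : CTensor E F →L[ℂ] CTensor E' F' :=
  lift (LinearMap.compl₁₂ tmul f.toLinearMap g.toLinearMap) <|
    continuous_tmul.comp (f.continuous.prodMap g.continuous)

@[simp]
theorem map_tmul (f : E →L[ℂ] E') (g : F →L[ℂ] F') (x : E) (y : F) :
    map f g (tmul x y) = tmul (f x) (g y) :=
  lift_tmul _ _ _ _

/-- The inverse associativity morphism `E ⊗ (F ⊗ G) → (E ⊗ F) ⊗ G`. -/
noncomputable def assocSymm : CTensor E (CTensor F G) →L[ℂ] CTensor (CTensor E F) G :=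
  (map comm (.id ℂ G)).comp (comm.comp (assoc.comp ((map comm (.id ℂ E)).comp comm)))

@[simp]
theorem assocSymm_tmul (x : E) (y : F) (z : G) :
    assocSymm (tmul x (tmul y z)) = tmul (tmul x y) z := by
  simp [assocSymm]

/-- The map `1 ⊗ f ⊗ 1 : (E ⊗ F) ⊗ (G ⊗ K) → (E ⊗ F') ⊗ (G' ⊗ K)`, for
`f : F ⊗ G → F' ⊗ G'`. -/
noncomputable def middle {G' : Type*} [AddCommGroup G'] [Module ℂ G'] [UniformSpace G'] [LCSpace G']
    (f : CTensor F G →L[ℂ] CTensor F' G') :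
    CTensor (CTensor E F) (CTensor G K) →L[ℂ] CTensor (CTensor E F') (CTensor G' K) :=
  assocSymm.comp
    ((map (.id ℂ E) (assoc.comp ((map f (.id ℂ K)).comp assocSymm))).comp assoc)

/-- The interchange map `(x ⊗ y) ⊗ (z ⊗ w) ↦ (x ⊗ z) ⊗ (y ⊗ w)`. -/
noncomputable def interchange :
    CTensor (CTensor E F) (CTensor G K) →L[ℂ] CTensor (CTensor E G) (CTensor F K) :=
  middle comm

@[simp]
theorem interchange_tmul (x : E) (y : F) (z : G) (w : K) :
    interchange (tmul (tmul x y) (tmul z w)) = tmul (tmul x z) (tmul y w) := by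
  simp [interchange, middle]

end Assoc

end CTensor

/-! ### Algebras, bialgebras and module algebras for the completed projective tensor product

A `⊗̂`-algebra is a complete Hausdorff locally convex algebra with jointly continuous
multiplication, i.e. a type `A` with instances
`[Ring A] [Algebra ℂ A] [UniformSpace A] [CompleteLCSpace A] [IsTopologicalRing A]`. -/

section Structures

open CTensor

variable (H : Type*) [Ring H] [Algebra ℂ H] [UniformSpace H] [CompleteLCSpace H]
  [IsTopologicalRing H]
variable (X : Type*) [AddCommGroup X] [Module ℂ X] [UniformSpace X] [CompleteLCSpace X]
variable (A : Type*) [Ring A] [Algebra ℂ A] [UniformSpace A] [CompleteLCSpace A]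
  [IsTopologicalRing A]

/-- The multiplication of a `⊗̂`-algebra as a map `A ⊗̂ A → A`. -/
noncomputable def mulHat : CTensor A A →L[ℂ] A :=
  lift (LinearMap.mul ℂ A) continuous_mul

@[simp]
theorem mulHat_tmul (a b : A) : mulHat A (tmul a b) = a * b := lift_tmul _ _ a b

/-- The canonical map `ℂ ⊗̂ X → X`. -/
noncomputable def lidHat : CTensor ℂ X →L[ℂ] X :=
  lift (LinearMap.lsmul ℂ X) continuous_smul

@[simp]
theorem lidHat_tmul (c : ℂ) (x : X) : lidHat X (tmul c x) = c • x := lift_tmul _ _ c x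

/-- The canonical map `X ⊗̂ ℂ → X`. -/
noncomputable def ridHat : CTensor X ℂ →L[ℂ] X := (lidHat X).comp comm

@[simp]
theorem ridHat_tmul (c : ℂ) (x : X) : ridHat X (tmul x c) = c • x := by
  simp [ridHat]

/-- The structure of a `⊗̂`-bialgebra on a `⊗̂`-algebra `H`. -/
structure HatBialgebra where
  /-- The comultiplication. -/
  comul : H →L[ℂ] CTensor H H
  /-- The counit. -/
  counit : H →L[ℂ] ℂ
  coassoc : assoc.comp ((CTensor.map comul (.id ℂ H)).comp comul) =
    (CTensor.map (.id ℂ H) comul).comp comul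
  counit_comul : (lidHat H).comp ((CTensor.map counit (.id ℂ H)).comp comul) = .id ℂ H
  comul_counit : (ridHat H).comp ((CTensor.map (.id ℂ H) counit).comp comul) = .id ℂ H
  /-- The comultiplication is multiplicative, where the product of `H ⊗̂ H` is
  `(x ⊗ y) (z ⊗ w) = x z ⊗ y w`. -/
  comul_mul : ∀ h k, comul (h * k) =
    CTensor.map (mulHat H) (mulHat H) (interchange (tmul (comul h) (comul k)))
  comul_one : comul 1 = tmul 1 1
  counit_mul : ∀ h k, counit (h * k) = counit h * counit k
  counit_one : counit 1 = 1

/-- The structure of a left `H`-`⊗̂`-module on a complete Hausdorff locally convex space `X`. -/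
structure HatModule where
  /-- The action. -/
  act : H →ₗ[ℂ] X →ₗ[ℂ] X
  continuous_act : Continuous fun z : H × X => act z.1 z.2
  mul_act : ∀ h k x, act (h * k) x = act h (act k x)
  one_act : ∀ x, act 1 x = x

variable {H X}

/-- The action as a map `H ⊗̂ X → X`. -/
noncomputable def HatModule.actHat (M : HatModule H X) : CTensor H X →L[ℂ] X :=
  lift M.act M.continuous_act

@[simp]
theorem HatModule.actHat_tmul (M : HatModule H X) (h : H) (x : X) :
    M.actHat (tmul h x) = M.act h x := lift_tmul _ _ h x

/-- The action of `h : H` on `X ⊗̂ X`, given by the comultiplication: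
`h · (x ⊗ y) = ∑ h₁ · x ⊗ h₂ · y`. -/
noncomputable def HatModule.tensorAct (B : HatBialgebra H) (M : HatModule H X) (h : H)
    (t : CTensor X X) : CTensor X X :=
  CTensor.map M.actHat M.actHat (interchange (tmul (B.comul h) t))

/-- The structure of an `H`-`⊗̂`-module algebra on a `⊗̂`-algebra `A`: a left `H`-`⊗̂`-module
structure such that the product `A ⊗̂ A → A` and the unit map `ℂ → A` are `H`-module morphisms. -/
structure HatModuleAlgebra (B : HatBialgebra H) extends HatModule H A where
  act_mul : ∀ h t, act h (mulHat A t) = mulHat A (toHatModule.tensorAct B h t)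
  act_one : ∀ (h : H) (c : ℂ), act h (algebraMap ℂ A c) = algebraMap ℂ A (B.counit h * c)

namespace HatModuleAlgebra

variable {A} {B : HatBialgebra H} (M : HatModuleAlgebra A B)

/-- The map `τ : H ⊗̂ A → A ⊗̂ H`, `h ⊗ a ↦ ∑ h₁ · a ⊗ h₂`, as the composition
`H ⊗ A → (H ⊗ H) ⊗ A ≅ H ⊗ (H ⊗ A) ≅ H ⊗ (A ⊗ H) ≅ (H ⊗ A) ⊗ H → A ⊗ H`. -/
noncomputable def tau : CTensor H A →L[ℂ] CTensor A H :=
  (CTensor.map M.actHat (.id ℂ H)).comp <| assocSymm.comp <|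
    (CTensor.map (.id ℂ H) comm).comp <| assoc.comp <| CTensor.map B.comul (.id ℂ A)

/-- The multiplication of the analytic smash product, the composition
`(A ⊗ H) ⊗ (A ⊗ H) → (A ⊗ A) ⊗ (H ⊗ H) → A ⊗ H` of `1 ⊗ τ ⊗ 1` and `μ_A ⊗ μ_H`. -/
noncomputable def smashHat : CTensor (CTensor A H) (CTensor A H) →L[ℂ] CTensor A H :=
  (CTensor.map (mulHat A) (mulHat H)).comp (middle M.tau)

/-- The multiplication of the analytic smash product as a bilinear map on `A ⊗̂ H`. -/
noncomputable def smashMul : CTensor A H →ₗ[ℂ] CTensor A H →ₗ[ℂ] CTensor A H :=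
  tmul.compr₂ M.smashHat.toLinearMap

end HatModuleAlgebra

/-- The locally convex space `E`, with the bilinear multiplication `mul` and the element `one`, is
an Arens-Michael algebra: a unital associative algebra, complete, Hausdorff, with topology generated
by a family of submultiplicative seminorms. -/
structure IsArensMichael {E : Type*} [AddCommGroup E] [Module ℂ E] [UniformSpace E]
    (mul : E →ₗ[ℂ] E →ₗ[ℂ] E) (one : E) : Prop where
  mul_assoc : ∀ x y z, mul (mul x y) z = mul x (mul y z)
  one_mul : ∀ x, mul one x = x
  mul_one : ∀ x, mul x one = x
  complete : CompleteSpace E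
  hausdorff : T2Space E
  locally_mconvex : ∃ S : Set (Seminorm ℂ E), (∀ p ∈ S, ∀ x y, p (mul x y) ≤ p x * p y) ∧
    (inferInstance : UniformSpace E) = seminormUniformity S

end Structures

/-! ### The extension of algebraic structures -/

section Extension

open CTensor

variable (H A : Type*) [Ring H] [Bialgebra ℂ H] [Ring A] [Algebra ℂ A] [Module H A]
  [IsScalarTower ℂ H A]

/-- `A` is an `H`-module algebra: `h · (a b) = ∑ (h₁ · a) (h₂ · b)` and `h · 1 = ε(h) 1`. -/
structure IsModuleAlgebra : Prop where
  smul_mul : ∀ (h : H) (a b : A), h • (a * b) = LinearMap.mul' ℂ A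
    (TensorProduct.map ((LinearMap.toSpanSingleton H A a).restrictScalars ℂ)
      ((LinearMap.toSpanSingleton H A b).restrictScalars ℂ) (Coalgebra.comul (R := ℂ) h))
  smul_one : ∀ h : H, h • (1 : A) = Coalgebra.counit (R := ℂ) h • (1 : A)

variable {H}

/-- The `⊗̂`-bialgebra structure `B` on the Arens-Michael envelope of `H` extends the bialgebra
structure of `H`. -/
def HatBialgebra.Extends (B : HatBialgebra (AMEnvelope H)) : Prop :=
  (∀ h : H, B.comul (AMEnvelope.ι H h) = ofTensor (TensorProduct.map (AMEnvelope.ι H).toLinearMap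
    (AMEnvelope.ι H).toLinearMap (Coalgebra.comul (R := ℂ) h))) ∧
  ∀ h : H, B.counit (AMEnvelope.ι H h) = Coalgebra.counit (R := ℂ) h

variable {A}

/-- The bilinear map `m` extends the action of `H` on `A` to an action of the Arens-Michael
envelope of `H` on the `H`-completion of `A`. -/
def ExtendsAction (m : AMEnvelope H →ₗ[ℂ] HCompletion H A →ₗ[ℂ] HCompletion H A) : Prop :=
  ∀ (h : H) (a : A), m (AMEnvelope.ι H h) (HCompletion.ι H A a) = HCompletion.ι H A (h • a)

end Extension

/-! ### The algebraic smash product represented in `E ⊗ H` -/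

section SmashRepresentation

/-! Extending the structure is a matter of finding submultiplicative seminorms. The projective
seminorm of two submultiplicative seminorms is submultiplicative, so its pullback along the algebra
homomorphism `Δ` is one of the seminorms defining `Ĥ`, and `Δ` is continuous; the counit is bounded
by `|ε|`. For a stable seminorm `q` on `A`, the operator seminorm `h ↦ ‖R_h‖`, where `R_h` is the
action of `h` on `(A, q)`, is submultiplicative and `q (h • a) ≤ ‖R_h‖ q a`; hence the action is
jointly continuous. All axioms and both uniqueness claims then follow by density.

The substantial point is that the smash product is Arens–Michael: a projective seminorm on `A ⊗ H`
has no reason to be submultiplicative for the twisted product. The remedy is a faithful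
representation. Let `L_a` be left multiplication by `a` on `(A, q)`, and send `a ⊗ h` to `∑ L_a
R_{h₁} ⊗ h₂` in `BoundedOperators q ⊗ H`. The module algebra axiom says `R_h L_b = ∑ L_{h₁ b}
R_{h₂}`, and together with coassociativity this makes the map multiplicative (`smashRep_mul`). Since
`h • 1 = ε(h) 1`, evaluating the operators at `1` gives a left inverse (`map_smashRep`).

Pulling back the projective seminorm of the operator seminorm and a submultiplicative `p` on `H`
gives a submultiplicative seminorm `N` on the smash product. It is continuous
(`smashSeminorm_tmul_le`), and the left inverse gives `q ⊗ p ≤ q(1) N`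
(`projSeminorm_le_smashSeminorm`), so the seminorms `N` generate the projective topology.
Faithfulness of the representation also yields associativity and the unit laws, without computing
with the twist. -/

/-- The linear map `h ↦ h • a`. -/
def orbitMap (H : Type*) {A : Type*} [Ring H] [Algebra ℂ H] [Ring A] [Algebra ℂ A] [Module H A]
    [IsScalarTower ℂ H A] (a : A) : H →ₗ[ℂ] A :=
  (LinearMap.toSpanSingleton H A a).restrictScalars ℂ

@[simp]
theorem orbitMap_apply {H A : Type*} [Ring H] [Algebra ℂ H] [Ring A] [Algebra ℂ A] [Module H A]
    [IsScalarTower ℂ H A] (a : A) (h : H) : orbitMap H a h = h • a := rfl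

variable {H A E : Type*} [Ring H] [Bialgebra ℂ H] [Ring A] [Algebra ℂ A]
  [Ring E] [Algebra ℂ E]

/-- The homomorphism `h ↦ ∑ R h₁ ⊗ h₂`. -/
noncomputable def coactionHom (R : H →ₐ[ℂ] E) : H →ₐ[ℂ] E ⊗[ℂ] H :=
  (Algebra.TensorProduct.map R (AlgHom.id ℂ H)).comp (Bialgebra.comulAlgHom ℂ H)

theorem coactionHom_apply (R : H →ₐ[ℂ] E) (h : H) : coactionHom R h =
    TensorProduct.map R.toLinearMap LinearMap.id (Coalgebra.comul (R := ℂ) h) := rfl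

/-- The map `a ⊗ h ↦ ∑ L a * R h₁ ⊗ h₂`. -/
noncomputable def smashRep (L : A →ₐ[ℂ] E) (R : H →ₐ[ℂ] E) : A ⊗[ℂ] H →ₗ[ℂ] E ⊗[ℂ] H :=
  TensorProduct.lift ((LinearMap.mul ℂ (E ⊗[ℂ] H)).compl₁₂
    ((Algebra.TensorProduct.includeLeft (R := ℂ) (S := ℂ) (A := E) (B := H)).toLinearMap ∘ₗ
      L.toLinearMap) (coactionHom R).toLinearMap)

theorem smashRep_tmul (L : A →ₐ[ℂ] E) (R : H →ₐ[ℂ] E) (a : A) (h : H) :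
    smashRep L R (a ⊗ₜ h) = (L a ⊗ₜ 1) * coactionHom R h := rfl

/-- Only multiplicativity of `L` and of `coactionHom R` enters: the outer factors of a smash product
need no commutation relation between `L` and `R`. -/
theorem smashRep_map_mul (L : A →ₐ[ℂ] E) (R : H →ₐ[ℂ] E) (a : A) (k : H) (t : A ⊗[ℂ] H) :
    smashRep L R (TensorProduct.map (LinearMap.mulLeft ℂ a) (LinearMap.mulRight ℂ k) t) =
      (L a ⊗ₜ 1) * smashRep L R t * coactionHom R k := by
  induction t with
  | zero => simp
  | add s t hs ht => simp only [map_add, mul_add, add_mul, hs, ht]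
  | tmul b h =>
    rw [TensorProduct.map_tmul, LinearMap.mulLeft_apply, LinearMap.mulRight_apply, smashRep_tmul,
      smashRep_tmul, map_mul, map_mul, ← mul_one (1 : H), ← Algebra.TensorProduct.tmul_mul_tmul,
      mul_one]
    simp only [mul_assoc]

/-- The map `ev` turns `∑ L a * R h₁ ⊗ h₂` into `∑ ε(h₁) a ⊗ h₂`, which is `a ⊗ h` by the counit
axiom. This provides a left inverse of `smashRep`, and later a norm estimate. -/
theorem map_smashRep (L : A →ₐ[ℂ] E) (R : H →ₐ[ℂ] E) (ev : E →ₗ[ℂ] A)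
    (hev : ∀ a h, ev (L a * R h) = Coalgebra.counit (R := ℂ) h • a) (u : A ⊗[ℂ] H) :
    TensorProduct.map ev LinearMap.id (smashRep L R u) = u := by
  induction u with
  | zero => simp
  | add s t hs ht => simp only [map_add, hs, ht]
  | tmul a h =>
    have h1 : ∀ s : H ⊗[ℂ] H, TensorProduct.map ev LinearMap.id
        ((L a ⊗ₜ 1) * TensorProduct.map R.toLinearMap LinearMap.id s) =
        TensorProduct.map (LinearMap.toSpanSingleton ℂ A a) LinearMap.id
          (Coalgebra.counit.rTensor H s) := by
      intro s
      induction s with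
      | zero => simp
      | add s t hs ht => simp only [map_add, mul_add, hs, ht]
      | tmul x y => simp [hev]
    rw [smashRep_tmul, coactionHom_apply, h1, Coalgebra.rTensor_counit_comul]
    simp

variable [Module H A] [IsScalarTower ℂ H A]

/-- The twist `h ⊗ a ↦ ∑ h₁ • a ⊗ h₂`. -/
noncomputable def smashTwist (h : H) (a : A) : A ⊗[ℂ] H :=
  TensorProduct.map (orbitMap H a) LinearMap.id (Coalgebra.comul (R := ℂ) h)

/-- The map `Ψ : x ⊗ y ⊗ z ↦ L (x • b) * R y ⊗ z` computes both sides. The left one applies it to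
`(1 ⊗ Δ) Δ h`; the right one, after commuting `R` past `L b` by `hLR`, applies it to `(Δ ⊗ 1) Δ h`.
Coassociativity identifies them. -/
theorem smashRep_smashTwist (L : A →ₐ[ℂ] E) (R : H →ₐ[ℂ] E)
    (hLR : ∀ h b, R h * L b = LinearMap.mul' ℂ E (TensorProduct.map
      (L.toLinearMap ∘ₗ orbitMap H b) R.toLinearMap (Coalgebra.comul (R := ℂ) h)))
    (h : H) (b : A) :
    smashRep L R (smashTwist h b) = coactionHom R h * (L b ⊗ₜ 1) := by
  let Ψ : (H ⊗[ℂ] H) ⊗[ℂ] H →ₗ[ℂ] E ⊗[ℂ] H := TensorProduct.map (LinearMap.mul' ℂ E ∘ₗ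
    TensorProduct.map (L.toLinearMap ∘ₗ orbitMap H b) R.toLinearMap) LinearMap.id
  have h1 : ∀ s : H ⊗[ℂ] H,
      smashRep L R (TensorProduct.map (orbitMap H b) LinearMap.id s) =
      Ψ ((TensorProduct.assoc ℂ H H H).symm (Coalgebra.comul.lTensor H s)) := by
    intro s
    induction s with
    | zero => simp
    | add s t hs ht => simp only [map_add, hs, ht]
    | tmul x y =>
      rw [TensorProduct.map_tmul, LinearMap.id_apply, smashRep_tmul, coactionHom_apply,
        LinearMap.lTensor_tmul]
      generalize Coalgebra.comul (R := ℂ) y = w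
      induction w with
      | zero => simp
      | add s t hs ht => simp only [map_add, mul_add, TensorProduct.tmul_add, hs, ht]
      | tmul u v => simp [Ψ]
  have h2 : ∀ s : H ⊗[ℂ] H,
      TensorProduct.map R.toLinearMap LinearMap.id s * (L b ⊗ₜ 1) =
      Ψ (Coalgebra.comul.rTensor H s) := by
    intro s
    induction s with
    | zero => simp
    | add s t hs ht => simp only [map_add, add_mul, hs, ht]
    | tmul x y => simp [Ψ, hLR]
  rw [smashTwist, h1, coactionHom_apply, h2, Coalgebra.coassoc_symm_apply]

theorem smashRep_mul (L : A →ₐ[ℂ] E) (R : H →ₐ[ℂ] E)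
    (hLR : ∀ h b, R h * L b = LinearMap.mul' ℂ E (TensorProduct.map
      (L.toLinearMap ∘ₗ orbitMap H b) R.toLinearMap (Coalgebra.comul (R := ℂ) h)))
    (a b : A) (h k : H) :
    smashRep L R (TensorProduct.map (LinearMap.mulLeft ℂ a) (LinearMap.mulRight ℂ k)
      (smashTwist h b)) = smashRep L R (a ⊗ₜ h) * smashRep L R (b ⊗ₜ k) := by
  rw [smashRep_map_mul, smashRep_smashTwist _ _ hLR, smashRep_tmul, smashRep_tmul]
  simp only [mul_assoc]

end SmashRepresentation

/-! ### Submultiplicative seminorms on tensor products -/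

section ProjSeminorm

open CTensor

variable {A B : Type*} [Ring A] [Algebra ℂ A] [Ring B] [Algebra ℂ B]

/-- The maximality property `le_projSeminorm` is used once per factor: first for left multiplication
by an elementary tensor, with constant `p a * q b`, then for right multiplication by `u`, with
constant `projSeminorm p q u`. -/
theorem isSubmultiplicative_projSeminorm {p : Seminorm ℂ A} {q : Seminorm ℂ B}
    (hp : IsSubmultiplicative p) (hq : IsSubmultiplicative q) :
    IsSubmultiplicative (projSeminorm p q) := by
  intro t u
  have h1 : ∀ a b, ∀ u, projSeminorm p q ((a ⊗ₜ[ℂ] b) * u) ≤ p a * q b * projSeminorm p q u := by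
    intro a b u
    refine le_projSeminorm p q ((projSeminorm p q).comp (LinearMap.mulLeft ℂ (a ⊗ₜ[ℂ] b))) _
      (by positivity) (fun x y => ?_) u
    have : (a ⊗ₜ[ℂ] b) * (x ⊗ₜ[ℂ] y) = (a * x) ⊗ₜ[ℂ] (b * y) := by simp
    rw [Seminorm.comp_apply, LinearMap.mulLeft_apply, this]
    refine (projSeminorm_tmul_le _ _ _ _).trans ?_
    calc p (a * x) * q (b * y) ≤ (p a * p x) * (q b * q y) :=
          mul_le_mul (hp a x) (hq b y) (by positivity) (by positivity)
      _ = _ := by ring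
  rw [mul_comm (projSeminorm p q t)]
  refine le_projSeminorm p q ((projSeminorm p q).comp (LinearMap.mulRight ℂ u)) _
      (by positivity) (fun x y => ?_) t
  rw [mul_comm]
  exact h1 x y u

theorem IsSubmultiplicative.comp {p : Seminorm ℂ B} (hp : IsSubmultiplicative p)
    (f : A →ₐ[ℂ] B) : IsSubmultiplicative (p.comp f.toLinearMap) := by
  intro a b
  simpa using hp (f a) (f b)

theorem isSubmultiplicative_normSeminorm (E : Type*) [SeminormedRing E] [NormedAlgebra ℂ E] :
    IsSubmultiplicative (normSeminorm ℂ E) :=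
  norm_mul_le

end ProjSeminorm

/-! ### Bounded operators for a seminorm -/

/-- A copy of the space `E`, normed by the seminorm `q`. -/
def NormedBySeminorm {E : Type*} [AddCommGroup E] [Module ℂ E] (_q : Seminorm ℂ E) : Type _ := E

namespace NormedBySeminorm

instance {E : Type*} [AddCommGroup E] [Module ℂ E] (q : Seminorm ℂ E) :
    SeminormedAddCommGroup (NormedBySeminorm q) :=
  q.toSeminormedAddCommGroup

instance {E : Type*} [AddCommGroup E] [Module ℂ E] (q : Seminorm ℂ E) :
    NormedSpace ℂ (NormedBySeminorm q) where
  __ := (inferInstance : Module ℂ E)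
  norm_smul_le c x := (map_smul_eq_mul q c x).le

/-- The seminormed algebra of operators that are bounded for the seminorm `q`. -/
def BoundedOperators {E : Type*} [AddCommGroup E] [Module ℂ E] (q : Seminorm ℂ E) : Type _ :=
  NormedBySeminorm q →L[ℂ] NormedBySeminorm q

noncomputable instance {E : Type*} [AddCommGroup E] [Module ℂ E] (q : Seminorm ℂ E) :
    SeminormedRing (BoundedOperators q) :=
  inferInstanceAs (SeminormedRing (NormedBySeminorm q →L[ℂ] NormedBySeminorm q))

noncomputable instance {E : Type*} [AddCommGroup E] [Module ℂ E] (q : Seminorm ℂ E) :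
    NormedAlgebra ℂ (BoundedOperators q) :=
  inferInstanceAs (NormedAlgebra ℂ (NormedBySeminorm q →L[ℂ] NormedBySeminorm q))

/-- The bounded operator defined by a linear map that is bounded for the seminorm `q`. -/
noncomputable def mkOperator {E : Type*} [AddCommGroup E] [Module ℂ E] (q : Seminorm ℂ E) (T : E →ₗ[ℂ] E)
    (hT : ∃ C : ℝ, ∀ x, q (T x) ≤ C * q x) : BoundedOperators q :=
  LinearMap.mkContinuousOfExistsBound (E := NormedBySeminorm q) (F := NormedBySeminorm q) T hT

variable {A : Type*} [Ring A] [Algebra ℂ A] {q : Seminorm ℂ A}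

/-- Left multiplications as bounded operators. -/
noncomputable def mulLeftHom (hq : IsSubmultiplicative q) :
    A →ₐ[ℂ] BoundedOperators q where
  toFun a := mkOperator q (LinearMap.mulLeft ℂ a) ⟨q a, fun x => hq a x⟩
  map_one' := ContinuousLinearMap.ext fun x => one_mul (M := A) x
  map_mul' a b := ContinuousLinearMap.ext fun x => mul_assoc (G := A) a b x
  map_zero' := ContinuousLinearMap.ext fun x => zero_mul (M₀ := A) x
  map_add' a b := ContinuousLinearMap.ext fun x => add_mul (R := A) a b x
  commutes' c := ContinuousLinearMap.ext fun x => (Algebra.smul_def (A := A) c x).symm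

theorem norm_mulLeftHom_le (hq : IsSubmultiplicative q) (a : A) : ‖mulLeftHom hq a‖ ≤ q a :=
  ContinuousLinearMap.opNorm_le_bound _ (apply_nonneg q a) fun x => hq a x

variable {H : Type*} [Ring H] [Algebra ℂ H] [Module H A] [IsScalarTower ℂ H A]

/-- By the scalar tower, `c` acts as the central element `c • 1` of `H`. -/
theorem _root_.smul_orbit_comm (h : H) (c : ℂ) (a : A) : h • c • a = c • h • a := by
  have h1 : c • a = (c • (1 : H)) • a := by rw [smul_assoc, one_smul]
  rw [h1, smul_smul, mul_smul_comm, mul_one, smul_assoc]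

/-- The action of `H` on `A`, by operators that are bounded for a stable seminorm. -/
noncomputable def actionHom (H : Type*) [Ring H] [Algebra ℂ H] [Module H A] [IsScalarTower ℂ H A]
    (hq : IsStableSeminorm H q) :
    H →ₐ[ℂ] BoundedOperators q where
  toFun h := mkOperator q
    { toFun := fun a : A => h • a
      map_add' := smul_add h
      map_smul' := smul_orbit_comm h } ((hq h).imp fun _ hC => hC.2)
  map_one' := ContinuousLinearMap.ext fun x => one_smul H (show A from x)
  map_mul' a b := ContinuousLinearMap.ext fun x => mul_smul a b (show A from x)
  map_zero' := ContinuousLinearMap.ext fun x => zero_smul H (show A from x)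
  map_add' a b := ContinuousLinearMap.ext fun x => add_smul a b (show A from x)
  commutes' c := ContinuousLinearMap.ext fun x => algebraMap_smul H c (show A from x)

/-- Evaluation of operators at `1`. -/
noncomputable def evalOne (q : Seminorm ℂ A) : BoundedOperators q →ₗ[ℂ] A where
  toFun T := (show NormedBySeminorm q →L[ℂ] NormedBySeminorm q from T) (1 : A)
  map_add' _ _ := rfl
  map_smul' _ _ := rfl

theorem seminorm_evalOne_le (T : BoundedOperators q) :
    q (evalOne q T) ≤ q 1 * ‖T‖ := by
  rw [mul_comm]
  exact ContinuousLinearMap.le_opNorm (E := NormedBySeminorm q) (F := NormedBySeminorm q) T (1 : A)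

/-- The operator seminorm on `H` defined by a stable seminorm on `A`. -/
noncomputable def actionSeminorm (H : Type*) [Ring H] [Algebra ℂ H] [Module H A]
    [IsScalarTower ℂ H A] (hq : IsStableSeminorm H q) : Seminorm ℂ H :=
  (normSeminorm ℂ (BoundedOperators q)).comp
    (actionHom H hq).toLinearMap

theorem isSubmultiplicative_actionSeminorm (hq : IsStableSeminorm H q) :
    IsSubmultiplicative (actionSeminorm H hq) :=
  (isSubmultiplicative_normSeminorm _).comp _

/-- This upgrades stability, a bound for each separate `h`, to a joint bound by a submultiplicative
seminorm of `h`; joint continuity of the extended action rests on it. -/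
theorem seminorm_smul_le (hq : IsStableSeminorm H q) (h : H) (a : A) :
    q (h • a) ≤ actionSeminorm H hq h * q a :=
  ContinuousLinearMap.le_opNorm (E := NormedBySeminorm q) (F := NormedBySeminorm q)
    (actionHom H hq h) a

end NormedBySeminorm

/-! ### Submultiplicative seminorms on the smash product -/

section SmashSeminorm

open CTensor NormedBySeminorm

variable {H A : Type*} [Ring H] [Bialgebra ℂ H] [Ring A] [Algebra ℂ A] [Module H A]
  [IsScalarTower ℂ H A] {q : Seminorm ℂ A}

/-- This is the axiom for `h • (b * x)`, read as an identity between operators in the variable `x`.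
-/
theorem actionHom_mul_mulLeftHom (hA : IsModuleAlgebra H A) (hq : IsSubmultiplicative q)
    (hs : IsStableSeminorm H q) (h : H) (b : A) :
    actionHom H hs h * mulLeftHom hq b = LinearMap.mul' ℂ _ (TensorProduct.map
      ((mulLeftHom hq).toLinearMap ∘ₗ orbitMap H b) (actionHom H hs).toLinearMap
      (Coalgebra.comul (R := ℂ) h)) := by
  refine ContinuousLinearMap.ext fun x : A => ?_
  refine (hA.smul_mul h b x).trans ?_
  generalize Coalgebra.comul (R := ℂ) h = s
  induction s with
  | zero => simp; rfl
  | add s t hs ht => simp only [map_add, hs, ht]; rfl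
  | tmul u v => rfl

theorem evalOne_mul (hA : IsModuleAlgebra H A) (hq : IsSubmultiplicative q)
    (hs : IsStableSeminorm H q) (a : A) (h : H) :
    evalOne q (mulLeftHom hq a * actionHom H hs h) = Coalgebra.counit (R := ℂ) h • a := by
  change a * h • (1 : A) = _
  rw [hA.smul_one, mul_smul_comm, mul_one]

/-- The representation of the smash product on `A ⊗ H` by bounded operators on `A`. -/
noncomputable def boundedSmashRep (hq : IsSubmultiplicative q) (hs : IsStableSeminorm H q) :
    A ⊗[ℂ] H →ₗ[ℂ] BoundedOperators q ⊗[ℂ] H :=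
  smashRep (mulLeftHom hq) (actionHom H hs)

theorem boundedSmashRep_one (hq : IsSubmultiplicative q) (hs : IsStableSeminorm H q) :
    boundedSmashRep hq hs (1 ⊗ₜ 1) = 1 := by
  rw [boundedSmashRep, smashRep_tmul, map_one, map_one, mul_one]
  rfl

theorem boundedSmashRep_mul (hA : IsModuleAlgebra H A) (hq : IsSubmultiplicative q)
    (hs : IsStableSeminorm H q) (a b : A) (h k : H) :
    boundedSmashRep hq hs (TensorProduct.map (LinearMap.mulLeft ℂ a) (LinearMap.mulRight ℂ k)
      (smashTwist h b)) = boundedSmashRep hq hs (a ⊗ₜ h) * boundedSmashRep hq hs (b ⊗ₜ k) :=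
  smashRep_mul _ _ (actionHom_mul_mulLeftHom hA hq hs) a b h k

theorem boundedSmashRep_injective (hA : IsModuleAlgebra H A) (hq : IsSubmultiplicative q)
    (hs : IsStableSeminorm H q) : Function.Injective (boundedSmashRep (H := H) hq hs) :=
  Function.LeftInverse.injective (map_smashRep _ _ _ (evalOne_mul hA hq hs))

/-- The seminorm on the smash product `A ⊗ H` defined by a stable submultiplicative seminorm on
`A` and a seminorm on `H`. -/
noncomputable def smashSeminorm (hq : IsSubmultiplicative q) (hs : IsStableSeminorm H q)
    (p : Seminorm ℂ H) : Seminorm ℂ (A ⊗[ℂ] H) :=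
  (projSeminorm (normSeminorm ℂ _) p).comp (boundedSmashRep hq hs)

/-- Evaluation at `1`, tensored with the identity of `H`, inverts the representation on the left,
and evaluation is bounded by `q 1` times the operator seminorm. Hence nothing is lost, up to a
constant, in passing to the submultiplicative seminorm. -/
theorem projSeminorm_le_smashSeminorm (hA : IsModuleAlgebra H A) (hq : IsSubmultiplicative q)
    (hs : IsStableSeminorm H q) (p : Seminorm ℂ H) (u : A ⊗[ℂ] H) :
    projSeminorm q p u ≤ q 1 * smashSeminorm hq hs p u := by
  have h1 := le_projSeminorm (normSeminorm ℂ (BoundedOperators q)) p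
    ((projSeminorm q p).comp (TensorProduct.map (evalOne q) LinearMap.id)) (q 1)
    (apply_nonneg q 1) (fun T h => ?_) (boundedSmashRep hq hs u)
  · rw [Seminorm.comp_apply, boundedSmashRep, map_smashRep _ _ _ (evalOne_mul hA hq hs)] at h1
    exact h1
  · refine (projSeminorm_tmul_le _ _ _ _).trans ?_
    rw [← mul_assoc]
    exact mul_le_mul_of_nonneg_right (seminorm_evalOne_le T) (apply_nonneg p h)

theorem smashSeminorm_le_mul (hq : IsSubmultiplicative q) (hs : IsStableSeminorm H q)
    {p : Seminorm ℂ H} (hp : IsSubmultiplicative p) {u s t : A ⊗[ℂ] H}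
    (h : boundedSmashRep hq hs u = boundedSmashRep hq hs s * boundedSmashRep hq hs t) :
    smashSeminorm hq hs p u ≤ smashSeminorm hq hs p s * smashSeminorm hq hs p t := by
  rw [smashSeminorm, Seminorm.comp_apply, h]
  exact isSubmultiplicative_projSeminorm
    (isSubmultiplicative_normSeminorm (BoundedOperators q)) hp _ _

/-- The seminorm on `H` induced along the comultiplication by `projSeminorm p₁ p₂`. -/
noncomputable def comulSeminorm (p₁ p₂ : Seminorm ℂ H) : Seminorm ℂ H :=
  (projSeminorm p₁ p₂).comp Coalgebra.comul

theorem isSubmultiplicative_comulSeminorm {p₁ p₂ : Seminorm ℂ H} (h₁ : IsSubmultiplicative p₁)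
    (h₂ : IsSubmultiplicative p₂) : IsSubmultiplicative (comulSeminorm p₁ p₂) :=
  (isSubmultiplicative_projSeminorm h₁ h₂).comp (Bialgebra.comulAlgHom ℂ H)

/-- The bound that makes `smashSeminorm` continuous for the projective topology. The factor
depending on `h` is again submultiplicative, being pulled back along `Δ` from a projective seminorm,
and is therefore continuous on `H`. -/
theorem smashSeminorm_tmul_le (hq : IsSubmultiplicative q) (hs : IsStableSeminorm H q)
    (p : Seminorm ℂ H) (a : A) (h : H) :
    smashSeminorm hq hs p (a ⊗ₜ h) ≤ q a * comulSeminorm (actionSeminorm H hs) p h := by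
  let N := normSeminorm ℂ (BoundedOperators q)
  have h1 : ∀ s : H ⊗[ℂ] H, projSeminorm N p ((mulLeftHom hq a ⊗ₜ 1) *
      TensorProduct.map (actionHom H hs).toLinearMap LinearMap.id s) ≤
      q a * projSeminorm (actionSeminorm H hs) p s := by
    intro s
    refine le_projSeminorm _ _ ((projSeminorm N p).comp
      (LinearMap.mulLeft ℂ (mulLeftHom hq a ⊗ₜ 1) ∘ₗ
      TensorProduct.map (actionHom H hs).toLinearMap LinearMap.id)) _ (apply_nonneg q a)
      (fun x y => ?_) s
    have h2 : (mulLeftHom hq a ⊗ₜ[ℂ] (1 : H)) * (actionHom H hs x ⊗ₜ[ℂ] y) =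
      (mulLeftHom hq a * actionHom H hs x) ⊗ₜ[ℂ] y := by simp
    change projSeminorm N p ((mulLeftHom hq a ⊗ₜ[ℂ] (1 : H)) * (actionHom H hs x ⊗ₜ[ℂ] y)) ≤ _
    rw [h2, ← mul_assoc]
    refine (projSeminorm_tmul_le _ _ _ _).trans
      (mul_le_mul_of_nonneg_right ?_ (apply_nonneg p y))
    exact (norm_mul_le _ _).trans
      (mul_le_mul_of_nonneg_right (norm_mulLeftHom_le hq a) (norm_nonneg _))
  exact h1 _

end SmashSeminorm

/-! ### Topologies defined by submultiplicative seminorms -/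

theorem continuous_of_seminorm_bounds {X G : Type*} [AddCommGroup X] [Module ℂ X] [UniformSpace X]
    [LCSpace X] [AddCommGroup G] [Module ℂ G] [UniformSpace G] [LCSpace G] (f : X →ₗ[ℂ] G)
    (hf : ∀ P : Seminorm ℂ G, Continuous P → ∃ p : Seminorm ℂ X, Continuous p ∧
      ∃ C : ℝ, ∀ x, P (f x) ≤ C * p x) : Continuous f := by
  refine continuous_of_continuousAt_zero f (continuousAt_of_bounds _ _ (map_zero f) fun P hP => ?_)
  obtain ⟨p, hp, C, hC⟩ := hf P hP
  exact ⟨fun x => C * p x, (continuous_const.mul hp).continuousAt, by simp, hC⟩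

/-- The canonical linear map to the completion. -/
def completionCoe (E : Type*) [AddCommGroup E] [Module ℂ E] [UniformSpace E] [LCSpace E] :
    E →ₗ[ℂ] UniformSpace.Completion E where
  toFun x := x
  map_add' := UniformSpace.Completion.coe_add
  map_smul' := UniformSpace.Completion.coe_smul

namespace SeminormAlgebra

variable {A : Type*} [Ring A] [Algebra ℂ A] {P : Seminorm ℂ A → Prop}

theorem continuous_seminorm {p : Seminorm ℂ A} (hp : IsSubmultiplicative p) (hP : P p) :
    @Continuous (SeminormAlgebra A P) ℝ _ _ p := by
  change @Continuous A ℝ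
    (seminormUniformity {p : Seminorm ℂ A | IsSubmultiplicative p ∧ P p}).toTopologicalSpace _ p
  have h : IsSubmultiplicative p ∧ P p := ⟨hp, hP⟩
  exact continuous_of_mem_seminormUniformity
    (S := {p : Seminorm ℂ A | IsSubmultiplicative p ∧ P p}) h

theorem _root_.IsSubmultiplicative.sup {p q : Seminorm ℂ A} (hp : IsSubmultiplicative p)
    (hq : IsSubmultiplicative q) : IsSubmultiplicative (p ⊔ q) := fun a b =>
  sup_le ((hp a b).trans (mul_le_mul le_sup_left le_sup_left (by positivity)
      ((apply_nonneg p a).trans le_sup_left)))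
    ((hq a b).trans (mul_le_mul le_sup_right le_sup_right (by positivity)
      ((apply_nonneg q a).trans le_sup_right)))

/-- A continuous seminorm is bounded by a multiple of a finite supremum of defining ones.
Submultiplicativity and `P` survive finite suprema, so a single defining seminorm suffices; `P 0`
covers the empty supremum. -/
theorem exists_bound (h0 : P 0) (hsup : ∀ p q, P p → P q → P (p ⊔ q))
    (r : Seminorm ℂ (SeminormAlgebra A P)) (hr : Continuous r) :
    ∃ p : Seminorm ℂ A, IsSubmultiplicative p ∧ P p ∧ ∃ C : ℝ, 0 ≤ C ∧
      ∀ a : A, r (of A P a) ≤ C * p a := by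
  have hz : IsSubmultiplicative (0 : Seminorm ℂ A) := fun a b => by simp
  have : Nonempty {p : Seminorm ℂ A | IsSubmultiplicative p ∧ P p} := ⟨⟨0, hz, h0⟩⟩
  have hw : WithSeminorms (E := SeminormAlgebra A P)
      (fun p : {p : Seminorm ℂ A | IsSubmultiplicative p ∧ P p} => p.1) :=
    (SeminormFamily.withSeminorms_iff_uniformSpace_eq_iInf (E := SeminormAlgebra A P) _).2 rfl
  obtain ⟨t, C, -, hC⟩ := Seminorm.bound_of_continuous hw r hr
  have hfin : ∀ t : Finset {p : Seminorm ℂ A | IsSubmultiplicative p ∧ P p},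
      IsSubmultiplicative (t.sup fun p => p.1) ∧ P (t.sup fun p => p.1) := by
    classical
    intro t
    induction t using Finset.induction_on with
    | empty => exact ⟨by simpa [Seminorm.bot_eq_zero] using hz,
        by simpa [Seminorm.bot_eq_zero] using h0⟩
    | insert p t hpt ih =>
      rw [Finset.sup_insert]
      exact ⟨p.2.1.sup ih.1, hsup _ _ p.2.2 ih.2⟩
  exact ⟨_, (hfin t).1, (hfin t).2, C, C.coe_nonneg, fun a => hC a⟩

theorem continuous_linearMap {G : Type*} [AddCommGroup G] [Module ℂ G] [UniformSpace G] [LCSpace G]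
    (f : SeminormAlgebra A P →ₗ[ℂ] G)
    (hf : ∀ r : Seminorm ℂ G, Continuous r → ∃ p : Seminorm ℂ A, IsSubmultiplicative p ∧ P p ∧
      ∃ C : ℝ, ∀ a : A, r (f (of A P a)) ≤ C * p a) : Continuous f := by
  refine continuous_of_seminorm_bounds f fun r hr => ?_
  obtain ⟨p, hp, hP, h⟩ := hf r hr
  exact ⟨p, continuous_seminorm hp hP, h⟩

end SeminormAlgebra

theorem IsStableSeminorm.zero {H A : Type*} [Ring H] [AddCommGroup A] [Module ℂ A] [Module H A] :
    IsStableSeminorm H (0 : Seminorm ℂ A) := fun _ => ⟨1, one_pos, fun _ => by simp⟩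

theorem IsStableSeminorm.sup {H A : Type*} [Ring H] [AddCommGroup A] [Module ℂ A] [Module H A]
    {p q : Seminorm ℂ A} (hp : IsStableSeminorm H p) (hq : IsStableSeminorm H q) :
    IsStableSeminorm H (p ⊔ q) := fun h => by
  obtain ⟨C, hC, h₁⟩ := hp h
  obtain ⟨D, hD, h₂⟩ := hq h
  refine ⟨max C D, lt_max_of_lt_left hC, fun x => sup_le ((h₁ x).trans ?_) ((h₂ x).trans ?_)⟩
  · exact mul_le_mul (le_max_left _ _) le_sup_left (by positivity) (by positivity)
  · exact mul_le_mul (le_max_right _ _) le_sup_right (by positivity) (by positivity)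

/-! ### Density and bounds for the two completions -/

section Envelopes

variable {H A : Type*} [Ring H] [Ring A] [Algebra ℂ A] [Module H A]

theorem HCompletion.denseRange_ι : DenseRange (HCompletion.ι H A) :=
  UniformSpace.Completion.denseRange_coe (α := SeminormAlgebra A (IsStableSeminorm H))

theorem HCompletion.exists_bound (r : Seminorm ℂ (HCompletion H A)) (hr : Continuous r) :
    ∃ p : Seminorm ℂ A, IsSubmultiplicative p ∧ IsStableSeminorm H p ∧ ∃ C : ℝ, 0 ≤ C ∧
      ∀ a, r (HCompletion.ι H A a) ≤ C * p a :=
  SeminormAlgebra.exists_bound (A := A) IsStableSeminorm.zero (fun _ _ => IsStableSeminorm.sup)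
    (r.comp (completionCoe (SeminormAlgebra A (IsStableSeminorm H))))
    (hr.comp (UniformSpace.Completion.continuous_coe _))

variable [Algebra ℂ H]

theorem AMEnvelope.denseRange_ι : DenseRange (AMEnvelope.ι H) :=
  UniformSpace.Completion.denseRange_coe (α := SeminormAlgebra H fun _ => True)

theorem AMEnvelope.exists_bound (r : Seminorm ℂ (AMEnvelope H)) (hr : Continuous r) :
    ∃ p : Seminorm ℂ H, IsSubmultiplicative p ∧ ∃ C : ℝ, 0 ≤ C ∧
      ∀ h, r (AMEnvelope.ι H h) ≤ C * p h := by
  obtain ⟨p, hp, -, h⟩ := SeminormAlgebra.exists_bound (A := H) trivial (fun _ _ _ _ => trivial)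
    (r.comp (completionCoe (SeminormAlgebra H fun _ => True)))
    (hr.comp (UniformSpace.Completion.continuous_coe _))
  exact ⟨p, hp, h⟩

/-- Linear maps on an algebra that are bounded by submultiplicative seminorms extend to its
Arens-Michael envelope. -/
theorem AMEnvelope.exists_extension {G : Type*} [AddCommGroup G] [Module ℂ G] [UniformSpace G]
    [CompleteLCSpace G] (f : H →ₗ[ℂ] G)
    (hf : ∀ r : Seminorm ℂ G, Continuous r → ∃ p : Seminorm ℂ H, IsSubmultiplicative p ∧
      ∃ C : ℝ, ∀ h : H, r (f h) ≤ C * p h) :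
    ∃ g : AMEnvelope H →L[ℂ] G, ∀ h, g (AMEnvelope.ι H h) = f h := by
  let f' : SeminormAlgebra H (fun _ => True) →L[ℂ] G :=
    { toLinearMap := f
      cont := SeminormAlgebra.continuous_linearMap (A := H) f fun r hr => by
        obtain ⟨p, hp, h⟩ := hf r hr
        exact ⟨p, hp, trivial, h⟩ }
  exact ⟨f'.fromCompletion, fun h => f'.fromCompletion_apply_coe h⟩

end Envelopes

/-! ### Extension of bilinear maps to completions -/

section BilinearExtension

open UniformSpace

variable {E F G : Type*}
  [AddCommGroup E] [Module ℂ E] [UniformSpace E] [LCSpace E]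
  [AddCommGroup F] [Module ℂ F] [UniformSpace F] [LCSpace F]
  [AddCommGroup G] [Module ℂ G] [UniformSpace G] [CompleteLCSpace G]

/-- Jointly continuous bilinear maps extend to completions. -/
theorem exists_bilinear_extension (B : E →ₗ[ℂ] F →ₗ[ℂ] G)
    (hB : Continuous fun z : E × F => B z.1 z.2) :
    ∃ B' : Completion E →ₗ[ℂ] Completion F →ₗ[ℂ] G,
      (Continuous fun z : Completion E × Completion F => B' z.1 z.2) ∧
      ∀ (x : E) (y : F), B' (x : Completion E) (y : Completion F) = B x y := by
  have de : IsDenseInducing (Completion.toCompl : E →+ Completion E) :=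
    Completion.isDenseInducing_coe
  have df : IsDenseInducing (Completion.toCompl : F →+ Completion F) :=
    Completion.isDenseInducing_coe
  let φ : E →+ F →+ G := AddMonoidHom.mk' (fun x => (B x).toAddMonoidHom) fun x y => by ext z; simp
  -- The extension theorem for biadditive maps gives only a continuous function; its bilinearity
  -- over `ℂ` is recovered by density below.
  obtain ⟨f, hc, hfc⟩ : ∃ f : Completion E × Completion F → G, Continuous f ∧
      ∀ (x : E) (y : F), f ((x : Completion E), (y : Completion F)) = B x y :=
    ⟨_, de.extend_Z_bilin df (φ := φ) hB, fun x y => (de.prodMap df).extend_eq hB (x, y)⟩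
  refine ⟨LinearMap.mk₂ ℂ (fun x y => f (x, y)) ?_ ?_ ?_ ?_, hc, hfc⟩
  · intro x x' y
    induction x, x', y using Completion.induction_on₃ with
    | hp => exact isClosed_eq (by fun_prop) (by fun_prop)
    | ih x x' y => rw [← Completion.coe_add, hfc, hfc, hfc, map_add, LinearMap.add_apply]
  · intro c x y
    induction x, y using Completion.induction_on₂ with
    | hp =>
      exact isClosed_eq
        (hc.comp (((continuous_const_smul c).comp continuous_fst).prodMk continuous_snd))
        (hc.const_smul c)
    | ih x y => rw [← Completion.coe_smul, hfc, hfc, map_smul, LinearMap.smul_apply]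
  · intro x y y'
    induction x, y, y' using Completion.induction_on₃ with
    | hp => exact isClosed_eq (by fun_prop) (by fun_prop)
    | ih x y y' => rw [← Completion.coe_add, hfc, hfc, hfc, map_add]
  · intro c x y
    induction x, y using Completion.induction_on₂ with
    | hp =>
      exact isClosed_eq
        (hc.comp (continuous_fst.prodMk ((continuous_const_smul c).comp continuous_snd)))
        (hc.const_smul c)
    | ih x y => rw [← Completion.coe_smul, hfc, hfc, map_smul]

end BilinearExtension

/-! ### Algebraic tensors inside completed tensor products -/

namespace CTensor

variable {E F X Y : Type*}
  [AddCommGroup E] [Module ℂ E] [UniformSpace E]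
  [AddCommGroup F] [Module ℂ F] [UniformSpace F]
  [AddCommGroup X] [Module ℂ X] [AddCommGroup Y] [Module ℂ Y]

/-- The map from the algebraic tensor product to the completed one induced by two linear maps. -/
noncomputable def ofMap (f : X →ₗ[ℂ] E) (g : Y →ₗ[ℂ] F) : X ⊗[ℂ] Y →ₗ[ℂ] CTensor E F :=
  ofTensor ∘ₗ TensorProduct.map f g

@[simp]
theorem ofMap_tmul (f : X →ₗ[ℂ] E) (g : Y →ₗ[ℂ] F) (x : X) (y : Y) :
    ofMap f g (x ⊗ₜ y) = tmul (f x) (g y) := rfl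

theorem projSeminorm_bound {f : X →ₗ[ℂ] E} {g : Y →ₗ[ℂ] F} {p : Seminorm ℂ X} {q : Seminorm ℂ Y}
    {r : Seminorm ℂ E} {s : Seminorm ℂ F} {C D : ℝ} (hC : 0 ≤ C) (hD : 0 ≤ D)
    (hr : ∀ x, r (f x) ≤ C * p x) (hs : ∀ y, s (g y) ≤ D * q y)
    (P : Seminorm ℂ (CTensor E F)) (hP : ∀ x y, P (tmul x y) ≤ r x * s y) (t : X ⊗[ℂ] Y) :
    P (ofMap f g t) ≤ C * D * projSeminorm p q t := by
  refine le_projSeminorm p q (P.comp (ofMap f g)) _ (by positivity) (fun x y => ?_) t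
  refine (hP _ _).trans ((mul_le_mul (hr x) (hs y) (by positivity) (by positivity)).trans ?_)
  exact le_of_eq (by ring)

variable [LCSpace E] [LCSpace F]

/-- The closure of the range is a closed subspace. It contains all elementary tensors by joint
continuity of `tmul`, hence all algebraic tensors, which are dense. -/
theorem denseRange_ofMap {f : X →ₗ[ℂ] E} {g : Y →ₗ[ℂ] F} (hf : DenseRange f) (hg : DenseRange g) :
    DenseRange (ofMap f g) := by
  let V : Submodule ℂ (CTensor E F) := (LinearMap.range (ofMap f g)).topologicalClosure
  have hV : IsClosed (V : Set (CTensor E F)) := Submodule.isClosed_topologicalClosure _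
  have h1 : ∀ x y, tmul x y ∈ V := by
    intro x y
    refine (hf.prodMap hg).induction_on (p := fun z : E × F => tmul z.1 z.2 ∈ V) (x, y)
      (hV.preimage continuous_tmul) fun z => ?_
    exact Submodule.le_topologicalClosure _ ⟨z.1 ⊗ₜ z.2, rfl⟩
  have h2 : ∀ t : E ⊗[ℂ] F, ofTensor t ∈ V := by
    intro t
    induction t with
    | zero => rw [map_zero]; exact zero_mem V
    | tmul x y => exact h1 x y
    | add s t hs ht => rw [map_add]; exact add_mem hs ht
  intro w
  exact denseRange_ofTensor.induction_on (p := fun w => w ∈ V) w hV h2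

end CTensor

/-- A locally convex topology on which every continuous seminorm is dominated by a seminorm of a
set `S` of continuous seminorms is generated by `S`. -/
theorem uniformSpace_eq_seminormUniformity {E : Type*} [AddCommGroup E] [Module ℂ E]
    [u : UniformSpace E] [LCSpace E] (S : Set (Seminorm ℂ E)) (hS : ∀ p ∈ S, Continuous p)
    (hdom : ∀ P : Seminorm ℂ E, Continuous P → ∃ p ∈ S, ∃ C : ℝ, ∀ x, P x ≤ C * p x) :
    u = seminormUniformity S := by
  have h1 : @Continuous E E u.toTopologicalSpace (seminormUniformity S).toTopologicalSpace
      (LinearMap.id : E →ₗ[ℂ] E) := continuous_rng_seminormUniformity LinearMap.id hS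
  have h2 : @Continuous E E (seminormUniformity S).toTopologicalSpace u.toTopologicalSpace
      (LinearMap.id : E →ₗ[ℂ] E) := by
    have hLC := lcSpace_seminormUniformity S
    refine @continuous_of_seminorm_bounds E E _ _ (seminormUniformity S) _ _ _ u _
      LinearMap.id fun P hP => ?_
    obtain ⟨p, hp, h⟩ := hdom P hP
    exact ⟨p, continuous_of_mem_seminormUniformity hp, h⟩
  have ht : u.toTopologicalSpace = (seminormUniformity S).toTopologicalSpace :=
    le_antisymm (continuous_id_iff_le.1 h1) (continuous_id_iff_le.1 h2)
  -- A uniformity compatible with the group structure is determined by its topology.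
  refine IsUniformAddGroup.ext inferInstance (seminormUniformity_isUniformAddGroup S) ?_
  rw [ht]

namespace CTensor

section OfMap

theorem ofMap_map {E F X Y X' Y' : Type*}
    [AddCommGroup E] [Module ℂ E] [UniformSpace E] [AddCommGroup F] [Module ℂ F] [UniformSpace F]
    [AddCommGroup X] [Module ℂ X] [AddCommGroup Y] [Module ℂ Y]
    [AddCommGroup X'] [Module ℂ X'] [AddCommGroup Y'] [Module ℂ Y']
    (f : X →ₗ[ℂ] E) (g : Y →ₗ[ℂ] F) (a : X' →ₗ[ℂ] X) (b : Y' →ₗ[ℂ] Y)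
    (t : X' ⊗[ℂ] Y') : ofMap f g (TensorProduct.map a b t) = ofMap (f ∘ₗ a) (g ∘ₗ b) t := by
  induction t with
  | zero => simp
  | add s t hs ht => simp only [map_add, hs, ht]
  | tmul x y => simp

variable {E F G E' F' X Y Z : Type*}
  [AddCommGroup E] [Module ℂ E] [UniformSpace E] [LCSpace E]
  [AddCommGroup F] [Module ℂ F] [UniformSpace F] [LCSpace F]
  [AddCommGroup G] [Module ℂ G] [UniformSpace G] [LCSpace G]
  [AddCommGroup E'] [Module ℂ E'] [UniformSpace E'] [LCSpace E']
  [AddCommGroup F'] [Module ℂ F'] [UniformSpace F'] [LCSpace F']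
  [AddCommGroup X] [Module ℂ X] [AddCommGroup Y] [Module ℂ Y] [AddCommGroup Z] [Module ℂ Z]

theorem _root_.Continuous.tmul {T : Type*} [TopologicalSpace T] {f : T → E} {g : T → F}
    (hf : Continuous f) (hg : Continuous g) : Continuous fun x => tmul (f x) (g x) :=
  continuous_tmul.comp (hf.prodMk hg)

theorem map_ofMap (φ : E →L[ℂ] E') (ψ : F →L[ℂ] F') (f : X →ₗ[ℂ] E) (g : Y →ₗ[ℂ] F)
    (t : X ⊗[ℂ] Y) :
    map φ ψ (ofMap f g t) = ofMap (φ.toLinearMap ∘ₗ f) (ψ.toLinearMap ∘ₗ g) t := by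
  induction t with
  | zero => simp
  | add s t hs ht => simp only [map_add, hs, ht]
  | tmul x y => simp

theorem assoc_ofMap (f : X →ₗ[ℂ] E) (g : Y →ₗ[ℂ] F) (k : Z →ₗ[ℂ] G) (t : (X ⊗[ℂ] Y) ⊗[ℂ] Z) :
    assoc (ofMap (ofMap f g) k t) = ofMap f (ofMap g k) (TensorProduct.assoc ℂ X Y Z t) := by
  induction t with
  | zero => simp
  | add s t hs ht => simp only [map_add, hs, ht]
  | tmul w z =>
    induction w with
    | zero => simp
    | add s t hs ht => simp only [map_add, TensorProduct.add_tmul, hs, ht]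
    | tmul x y => simp

end OfMap

end CTensor

open CTensor

/-! ### Bialgebra structures extended from a dense subalgebra -/

section DenseBialgebra

variable {H K : Type*} [Ring H] [Bialgebra ℂ H]
  [Ring K] [Algebra ℂ K] [UniformSpace K]

/-- The comultiplication is continuous for the topology of submultiplicative seminorms. -/
theorem exists_comul_bound (i : H →ₐ[ℂ] K)
    (hb : ∀ r : Seminorm ℂ K, Continuous r → ∃ p : Seminorm ℂ H, IsSubmultiplicative p ∧
      ∃ C : ℝ, 0 ≤ C ∧ ∀ h, r (i h) ≤ C * p h)
    (P : Seminorm ℂ (CTensor K K)) (hP : Continuous P) :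
    ∃ p : Seminorm ℂ H, IsSubmultiplicative p ∧ ∃ C : ℝ, ∀ h : H,
      P (ofMap i.toLinearMap i.toLinearMap (Coalgebra.comul (R := ℂ) h)) ≤ C * p h := by
  obtain ⟨r, s, hr, hs, h⟩ := exists_bound_tmul P hP
  obtain ⟨p, hp, C, hC, h1⟩ := hb r hr
  obtain ⟨q, hq, D, hD, h2⟩ := hb s hs
  -- The projective seminorm of `p` and `q`, pulled back along `Δ`, is submultiplicative because `Δ`
  -- is an algebra homomorphism.
  exact ⟨comulSeminorm p q, isSubmultiplicative_comulSeminorm hp hq, C * D, fun a =>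
    projSeminorm_bound hC hD h1 h2 P h _⟩

theorem exists_counit_bound (P : Seminorm ℂ ℂ) :
    ∃ p : Seminorm ℂ H, IsSubmultiplicative p ∧ ∃ C : ℝ, ∀ h : H,
      P (Coalgebra.counit (R := ℂ) h) ≤ C * p h := by
  -- Every seminorm on `ℂ` is `P 1` times the absolute value, and `|ε|` is submultiplicative.
  refine ⟨(normSeminorm ℂ ℂ).comp (Bialgebra.counitAlgHom ℂ H).toLinearMap,
    (isSubmultiplicative_normSeminorm ℂ).comp _, P 1, fun h => ?_⟩
  have : Coalgebra.counit (R := ℂ) h = Coalgebra.counit (R := ℂ) h • (1 : ℂ) := by simp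
  rw [this, map_smul_eq_mul, mul_comm]
  rfl

theorem ContinuousLinearMap.ext_of_dense {i : H →ₐ[ℂ] K} (hi : DenseRange i)
    {G : Type*} [AddCommGroup G] [Module ℂ G] [TopologicalSpace G]
    [T2Space G] {f g : K →L[ℂ] G} (h : ∀ a, f (i a) = g (i a)) : f = g :=
  DFunLike.coe_injective (hi.equalizer f.continuous g.continuous (funext h))

variable [CompleteLCSpace K] [IsTopologicalRing K]

theorem HatBialgebra.eq_of_dense {i : H →ₐ[ℂ] K} (hi : DenseRange i) {B B' : HatBialgebra K}
    (h₁ : ∀ a, B.comul (i a) = B'.comul (i a)) (h₂ : ∀ a, B.counit (i a) = B'.counit (i a)) :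
    B = B' := by
  have h1 : B.comul = B'.comul := ContinuousLinearMap.ext_of_dense hi h₁
  have h2 : B.counit = B'.counit := ContinuousLinearMap.ext_of_dense hi h₂
  cases B
  cases B'
  congr

/-- On algebraic tensors the product of `K ⊗̂ K` is that of `H ⊗ H`; with this, multiplicativity of
the extended comultiplication reduces to that of `Δ`. -/
theorem mulHat_interchange_ofMap (i : H →ₐ[ℂ] K) (s t : H ⊗[ℂ] H) :
    CTensor.map (mulHat K) (mulHat K) (interchange (tmul
      (ofMap i.toLinearMap i.toLinearMap s) (ofMap i.toLinearMap i.toLinearMap t))) =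
    ofMap i.toLinearMap i.toLinearMap (s * t) := by
  induction s with
  | zero => simp
  | add s s' hs hs' => simp only [map_add, add_mul, LinearMap.add_apply, hs, hs']
  | tmul x y =>
    induction t with
    | zero => simp
    | add s s' hs hs' => simp only [map_add, mul_add, hs, hs']
    | tmul z w => simp

/-- Continuous extensions of the comultiplication and the counit along a homomorphism with dense
range define a bialgebra structure. -/
theorem exists_hatBialgebra_of_dense {i : H →ₐ[ℂ] K} (hi : DenseRange i)
    (D : K →L[ℂ] CTensor K K)
    (hD : ∀ h, D (i h) = ofMap i.toLinearMap i.toLinearMap (Coalgebra.comul (R := ℂ) h))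
    (e : K →L[ℂ] ℂ) (he : ∀ h, e (i h) = Coalgebra.counit (R := ℂ) h) :
    ∃ B : HatBialgebra K, B.comul = D ∧ B.counit = e := by
  have hDi : D.toLinearMap ∘ₗ i.toLinearMap =
      ofMap i.toLinearMap i.toLinearMap ∘ₗ Coalgebra.comul := LinearMap.ext hD
  have hei : e.toLinearMap ∘ₗ i.toLinearMap = Coalgebra.counit := LinearMap.ext he
  refine ⟨⟨D, e, ?_, ?_, ?_, ?_, ?_, ?_, ?_⟩, rfl, rfl⟩
  · refine ContinuousLinearMap.ext_of_dense hi fun h => ?_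
    simp only [ContinuousLinearMap.comp_apply, hD]
    rw [map_ofMap, map_ofMap, hDi]
    -- Both iterated comultiplications are rewritten as images of algebraic ones, so that
    -- coassociativity in `H` applies under `ofMap`.
    have h1 := ofMap_map (ofMap i.toLinearMap i.toLinearMap) i.toLinearMap Coalgebra.comul
      LinearMap.id (Coalgebra.comul (R := ℂ) h)
    have h2 := ofMap_map i.toLinearMap (ofMap i.toLinearMap i.toLinearMap) LinearMap.id
      Coalgebra.comul (Coalgebra.comul (R := ℂ) h)
    refine (congrArg assoc h1.symm).trans (Eq.trans ?_ h2)
    rw [assoc_ofMap]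
    exact congrArg _ (Coalgebra.coassoc_apply h)
  · refine ContinuousLinearMap.ext_of_dense hi fun h => ?_
    simp only [ContinuousLinearMap.comp_apply, hD]
    rw [map_ofMap, hei]
    have h1 := ofMap_map LinearMap.id i.toLinearMap (Coalgebra.counit (R := ℂ)) LinearMap.id
      (Coalgebra.comul (R := ℂ) h)
    refine (congrArg (lidHat _) (h1.symm.trans
      (congrArg _ (Coalgebra.rTensor_counit_comul h)))).trans ?_
    simp
  · refine ContinuousLinearMap.ext_of_dense hi fun h => ?_
    simp only [ContinuousLinearMap.comp_apply, hD]
    rw [map_ofMap, hei]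
    have h1 := ofMap_map i.toLinearMap LinearMap.id LinearMap.id (Coalgebra.counit (R := ℂ))
      (Coalgebra.comul (R := ℂ) h)
    refine (congrArg (ridHat _) (h1.symm.trans
      (congrArg _ (Coalgebra.lTensor_counit_comul h)))).trans ?_
    simp
  · intro h k
    refine hi.induction_on₂ (p := fun h k => D (h * k) =
      CTensor.map (mulHat _) (mulHat _) (interchange (tmul (D h) (D k)))) ?_ (fun a b => ?_) h k
    · exact isClosed_eq (D.continuous.comp continuous_mul)
        ((CTensor.map _ _).continuous.comp (interchange.continuous.comp
          ((D.continuous.comp continuous_fst).tmul (D.continuous.comp continuous_snd))))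
    · rw [← map_mul, hD, hD, hD, mulHat_interchange_ofMap, Bialgebra.comul_mul]
  · have := hD 1
    rw [map_one, Bialgebra.comul_one] at this
    rw [this, Algebra.TensorProduct.one_def, ofMap_tmul]
    simp
  · intro h k
    refine hi.induction_on₂ (p := fun h k => e (h * k) = e h * e k) ?_ (fun a b => ?_) h k
    · exact isClosed_eq (e.continuous.comp continuous_mul)
        ((e.continuous.comp continuous_fst).mul (e.continuous.comp continuous_snd))
    · rw [← map_mul, he, he, he, Bialgebra.counit_mul]
  · have := he 1
    rwa [map_one, Bialgebra.counit_one] at this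

end DenseBialgebra

/-! ### Module algebra structures extended from dense subalgebras -/

section DenseModuleAlgebra

variable {H A K X : Type*} [Ring H] [Bialgebra ℂ H] [Ring A] [Algebra ℂ A] [Module H A]
  [IsScalarTower ℂ H A]
  [Ring K] [Algebra ℂ K] [UniformSpace K] [CompleteLCSpace K] [IsTopologicalRing K]
  [Ring X] [Algebra ℂ X] [UniformSpace X] [CompleteLCSpace X] [IsTopologicalRing X]
  {i : H →ₐ[ℂ] K} {j : A →ₐ[ℂ] X}

theorem mulHat_actHat_ofMap (M : HatModule K X) (hM : ∀ h a, M.act (i h) (j a) = j (h • a))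
    (s : H ⊗[ℂ] H) (a b : A) :
    mulHat X (CTensor.map M.actHat M.actHat (interchange
      (tmul (ofMap i.toLinearMap i.toLinearMap s) (tmul (j a) (j b))))) =
    j (LinearMap.mul' ℂ A (TensorProduct.map (orbitMap H a) (orbitMap H b) s)) := by
  induction s with
  | zero => simp
  | add s t hs ht => simp only [map_add, LinearMap.add_apply, hs, ht]
  | tmul x y => simp [hM]

/-- A continuous extension of the action along homomorphisms with dense range defines a structure
of module algebra. -/
theorem exists_hatModuleAlgebra_of_dense (hA : IsModuleAlgebra H A) (hi : DenseRange i)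
    (hj : DenseRange j) (B : HatBialgebra K)
    (hD : ∀ h, B.comul (i h) = ofMap i.toLinearMap i.toLinearMap (Coalgebra.comul (R := ℂ) h))
    (he : ∀ h, B.counit (i h) = Coalgebra.counit (R := ℂ) h)
    (m : K →ₗ[ℂ] X →ₗ[ℂ] X) (hc : Continuous fun z : K × X => m z.1 z.2)
    (hm : ∀ h a, m (i h) (j a) = j (h • a)) :
    ∃ M : HatModuleAlgebra X B, M.act = m := by
  have hmul : ∀ h k x, m (h * k) x = m h (m k x) := by
    intro h k x
    refine (hi.prodMap (hi.prodMap hj)).induction_on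
      (p := fun z : K × K × X => m (z.1 * z.2.1) z.2.2 = m z.1 (m z.2.1 z.2.2)) (h, k, x) ?_ ?_
    · exact isClosed_eq (hc.comp ((continuous_fst.mul (continuous_fst.comp continuous_snd)).prodMk
        (continuous_snd.comp continuous_snd)))
        (hc.comp (continuous_fst.prodMk (hc.comp continuous_snd)))
    · rintro ⟨a, b, x⟩
      change m (i a * i b) (j x) = m (i a) (m (i b) (j x))
      rw [← map_mul, hm, hm, hm, mul_smul]
  have hone : ∀ x, m 1 x = x := by
    intro x
    refine hj.induction_on (p := fun x => m 1 x = x) x ?_ fun a => ?_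
    · exact isClosed_eq (hc.comp (continuous_const.prodMk continuous_id)) continuous_id
    · have := hm 1 a
      rwa [map_one, one_smul] at this
  let M : HatModule K X := ⟨m, hc, hmul, hone⟩
  refine ⟨⟨M, ?_, ?_⟩, rfl⟩
  · intro h t
    -- The tensor `t` ranges over the completed product, so density of the image of `A ⊗ A` is
    -- needed, rather than that of `A` alone.
    have hd := denseRange_ofMap (f := j.toLinearMap) (g := j.toLinearMap) hj hj
    refine (hi.prodMap hd).induction_on (p := fun z : K × CTensor X X =>
      m z.1 (mulHat _ z.2) = mulHat _ (M.tensorAct B z.1 z.2)) (h, t) ?_ ?_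
    · exact isClosed_eq
        (hc.comp (continuous_fst.prodMk ((mulHat _).continuous.comp continuous_snd)))
        ((mulHat _).continuous.comp ((CTensor.map _ _).continuous.comp (interchange.continuous.comp
          ((B.comul.continuous.comp continuous_fst).tmul continuous_snd))))
    · rintro ⟨h, t⟩
      change m (i h) (mulHat _ (ofMap _ _ t)) = mulHat _ (CTensor.map _ _
        (interchange (tmul (B.comul (i h)) (ofMap _ _ t))))
      induction t with
      | zero => simp
      | add s t hs ht => simp only [map_add, hs, ht]
      | tmul a b =>
        rw [ofMap_tmul, hD]
        refine Eq.trans ?_ (mulHat_actHat_ofMap M hm (Coalgebra.comul (R := ℂ) h) a b).symm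
        rw [mulHat_tmul]
        change m (i h) (j a * j b) = _
        rw [← map_mul, hm, hA.smul_mul]
        rfl
  · intro h c
    refine hi.induction_on (p := fun h => m h (algebraMap ℂ _ c) =
      algebraMap ℂ X (B.counit h * c)) h ?_ fun h => ?_
    · refine isClosed_eq (hc.comp (continuous_id.prodMk continuous_const)) ?_
      simp only [Algebra.algebraMap_eq_smul_one]
      exact (B.counit.continuous.mul continuous_const).smul continuous_const
    · have h1 := hm h (algebraMap ℂ A c)
      rw [AlgHom.commutes] at h1
      rw [h1, he, Algebra.algebraMap_eq_smul_one c, smul_orbit_comm, hA.smul_one, smul_smul,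
        mul_comm, map_smul, map_one, Algebra.algebraMap_eq_smul_one]

end DenseModuleAlgebra

/-! ### The analytic smash product -/

section Smash

variable {H A K X : Type*} [Ring H] [Bialgebra ℂ H] [Ring A] [Algebra ℂ A] [Module H A]
  [IsScalarTower ℂ H A]
  [Ring K] [Algebra ℂ K] [UniformSpace K] [CompleteLCSpace K] [IsTopologicalRing K]
  [Ring X] [Algebra ℂ X] [UniformSpace X] [CompleteLCSpace X] [IsTopologicalRing X]
  {i : H →ₐ[ℂ] K} {j : A →ₐ[ℂ] X} {B : HatBialgebra K}

/-- On the dense subalgebras `τ` is the algebraic twist, so its values there are finite sums, to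
which the representation `smashRep` applies. -/
theorem tau_tmul_of_extends (M : HatModuleAlgebra X B)
    (hD : ∀ h, B.comul (i h) = ofMap i.toLinearMap i.toLinearMap (Coalgebra.comul (R := ℂ) h))
    (hM : ∀ h a, M.act (i h) (j a) = j (h • a)) (h : H) (b : A) :
    M.tau (tmul (i h) (j b)) = ofMap j.toLinearMap i.toLinearMap (smashTwist h b) := by
  have h1 : ∀ s : H ⊗[ℂ] H, CTensor.map M.actHat (.id ℂ K) (assocSymm
      (CTensor.map (.id ℂ K) comm (assoc (tmul (ofMap i.toLinearMap i.toLinearMap s) (j b))))) =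
      ofMap j.toLinearMap i.toLinearMap (TensorProduct.map (orbitMap H b) LinearMap.id s) := by
    intro s
    induction s with
    | zero => simp
    | add s t hs ht => simp only [map_add, LinearMap.add_apply, hs, ht]
    | tmul x y => simp [hM]
  rw [smashTwist, ← h1, ← hD]
  simp [HatModuleAlgebra.tau]

theorem smashMul_tmul (M : HatModuleAlgebra X B) (x y : X) (h k : K) :
    M.smashMul (tmul x h) (tmul y k) = CTensor.map (mulHat X) (mulHat K)
      (assocSymm (tmul x (assoc (tmul (M.tau (tmul h y)) k)))) := by
  change M.smashHat (tmul (tmul x h) (tmul y k)) = _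
  simp [HatModuleAlgebra.smashHat, middle]

theorem Continuous.smashMul (M : HatModuleAlgebra X B) {T : Type*} [TopologicalSpace T]
    {f g : T → CTensor X K} (hf : Continuous f) (hg : Continuous g) :
    Continuous fun x => M.smashMul (f x) (g x) :=
  M.smashHat.continuous.comp (hf.tmul hg)

theorem smashMul_tmul_of_extends (M : HatModuleAlgebra X B)
    (hD : ∀ h, B.comul (i h) = ofMap i.toLinearMap i.toLinearMap (Coalgebra.comul (R := ℂ) h))
    (hM : ∀ h a, M.act (i h) (j a) = j (h • a)) (a b : A) (h k : H) :
    M.smashMul (tmul (j a) (i h)) (tmul (j b) (i k)) = ofMap j.toLinearMap i.toLinearMap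
      (TensorProduct.map (LinearMap.mulLeft ℂ a) (LinearMap.mulRight ℂ k) (smashTwist h b)) := by
  rw [smashMul_tmul, tau_tmul_of_extends M hD hM]
  generalize smashTwist h b = t
  induction t with
  | zero => simp
  | add s t hs ht => simp only [map_add, LinearMap.add_apply, hs, ht]
  | tmul c l => simp

/-- The algebraic smash product is closed under the multiplication of the analytic one, and acts
by bounded operators. -/
theorem exists_smashMul_ofMap (hA : IsModuleAlgebra H A) (M : HatModuleAlgebra X B)
    (hD : ∀ h, B.comul (i h) = ofMap i.toLinearMap i.toLinearMap (Coalgebra.comul (R := ℂ) h))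
    (hM : ∀ h a, M.act (i h) (j a) = j (h • a)) (s t : A ⊗[ℂ] H) :
    ∃ u : A ⊗[ℂ] H, M.smashMul (ofMap j.toLinearMap i.toLinearMap s)
        (ofMap j.toLinearMap i.toLinearMap t) = ofMap j.toLinearMap i.toLinearMap u ∧
      ∀ (q : Seminorm ℂ A) (hq : IsSubmultiplicative q) (hs : IsStableSeminorm H q),
        boundedSmashRep hq hs u = boundedSmashRep hq hs s * boundedSmashRep hq hs t := by
  -- The tensor `u` is found before `q` is given: one `u` serves all representations. It is only
  -- asserted to exist, since `ofMap` may have a kernel and then does not determine it.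
  induction s with
  | zero => exact ⟨0, by simp, by simp⟩
  | add s s' hs hs' =>
    obtain ⟨u, hu, hu'⟩ := hs
    obtain ⟨v, hv, hv'⟩ := hs'
    exact ⟨u + v, by simp only [map_add, LinearMap.add_apply, hu, hv],
      fun q hq hs => by simp only [map_add, add_mul, hu', hv']⟩
  | tmul a h =>
    induction t with
    | zero => exact ⟨0, by simp, by simp⟩
    | add s s' hs hs' =>
      obtain ⟨u, hu, hu'⟩ := hs
      obtain ⟨v, hv, hv'⟩ := hs'
      exact ⟨u + v, by simp only [map_add, hu, hv],
        fun q hq hs => by simp only [map_add, mul_add, hu', hv']⟩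
    | tmul b k =>
      exact ⟨_, smashMul_tmul_of_extends M hD hM a b h k,
        fun q hq hs => boundedSmashRep_mul hA hq hs a b h k⟩

/-- The analytic smash product is an Arens-Michael algebra, provided that the topologies are
defined by seminorms that are bounded by submultiplicative ones on the dense subalgebras. -/
theorem isArensMichael_smashMul (hA : IsModuleAlgebra H A) (hi : DenseRange i)
    (hj : DenseRange j) (M : HatModuleAlgebra X B)
    (hD : ∀ h, B.comul (i h) = ofMap i.toLinearMap i.toLinearMap (Coalgebra.comul (R := ℂ) h))
    (hM : ∀ h a, M.act (i h) (j a) = j (h • a))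
    (hbi : ∀ r : Seminorm ℂ K, Continuous r → ∃ p : Seminorm ℂ H, IsSubmultiplicative p ∧
      ∃ C : ℝ, 0 ≤ C ∧ ∀ h, r (i h) ≤ C * p h)
    (hbj : ∀ r : Seminorm ℂ X, Continuous r → ∃ q : Seminorm ℂ A, IsSubmultiplicative q ∧
      IsStableSeminorm H q ∧ ∃ C : ℝ, 0 ≤ C ∧ ∀ a, r (j a) ≤ C * q a)
    (hN : ∀ (q : Seminorm ℂ A) (hq : IsSubmultiplicative q) (hs : IsStableSeminorm H q)
      (p : Seminorm ℂ H), IsSubmultiplicative p → ∃ N : Seminorm ℂ (CTensor X K), Continuous N ∧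
        ∀ u, N (ofMap j.toLinearMap i.toLinearMap u) = smashSeminorm hq hs p u) :
    IsArensMichael M.smashMul (tmul 1 1) := by
  have hd : DenseRange (ofMap j.toLinearMap i.toLinearMap) := denseRange_ofMap hj hi
  have hz : IsSubmultiplicative (0 : Seminorm ℂ A) := fun a b => by simp
  have h1 : (tmul 1 1 : CTensor X K) = ofMap j.toLinearMap i.toLinearMap (1 ⊗ₜ 1) := by simp
  refine ⟨?_, ?_, ?_, inferInstance, inferInstance, ?_⟩
  · intro x y z
    refine hd.induction_on₃ (p := fun x y z => M.smashMul (M.smashMul x y) z =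
      M.smashMul x (M.smashMul y z)) ?_ (fun s t u => ?_) x y z
    · exact isClosed_eq
        (.smashMul M (.smashMul M continuous_fst (continuous_fst.comp continuous_snd))
          (continuous_snd.comp continuous_snd))
        (.smashMul M continuous_fst (.smashMul M (continuous_fst.comp continuous_snd)
          (continuous_snd.comp continuous_snd)))
    · obtain ⟨st, hst, hst'⟩ := exists_smashMul_ofMap hA M hD hM s t
      obtain ⟨tu, htu, htu'⟩ := exists_smashMul_ofMap hA M hD hM t u
      obtain ⟨v, hv, hv'⟩ := exists_smashMul_ofMap hA M hD hM st u
      obtain ⟨w, hw, hw'⟩ := exists_smashMul_ofMap hA M hD hM s tu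
      rw [hst, htu, hv, hw]
      congr 1
      -- Injectivity of the representation is algebraic and holds for every admissible seminorm. The
      -- zero seminorm is always admissible, and it transfers associativity from `BoundedOperators 0
      -- ⊗ H`.
      refine boundedSmashRep_injective hA hz IsStableSeminorm.zero ?_
      rw [hv', hw', hst', htu', mul_assoc]
  · intro x
    refine hd.induction_on (p := fun x => M.smashMul (tmul 1 1) x = x) x
      (isClosed_eq (.smashMul M continuous_const continuous_id) continuous_id) fun s => ?_
    rw [h1]
    obtain ⟨u, hu, hu'⟩ := exists_smashMul_ofMap hA M hD hM (1 ⊗ₜ 1) s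
    rw [hu]
    congr 1
    refine boundedSmashRep_injective hA hz IsStableSeminorm.zero ?_
    rw [hu', boundedSmashRep_one, one_mul]
  · intro x
    refine hd.induction_on (p := fun x => M.smashMul x (tmul 1 1) = x) x
      (isClosed_eq (.smashMul M continuous_id continuous_const) continuous_id) fun s => ?_
    rw [h1]
    obtain ⟨u, hu, hu'⟩ := exists_smashMul_ofMap hA M hD hM s (1 ⊗ₜ 1)
    rw [hu]
    congr 1
    refine boundedSmashRep_injective hA hz IsStableSeminorm.zero ?_
    rw [hu', boundedSmashRep_one, mul_one]
  -- With all continuous submultiplicative seminorms taken as the family, it remains to dominate an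
  -- arbitrary continuous `P` by one of them.
  · refine ⟨{N | Continuous N ∧ ∀ x y, N (M.smashMul x y) ≤ N x * N y}, fun p hp => hp.2,
      uniformSpace_eq_seminormUniformity _ (fun p hp => hp.1) fun P hP => ?_⟩
    obtain ⟨r, s, hr, hs, h⟩ := exists_bound_tmul P hP
    obtain ⟨q, hq, hqs, C, hC, hqC⟩ := hbj r hr
    obtain ⟨p, hp, D, hDn, hpD⟩ := hbi s hs
    obtain ⟨N, hNc, hN⟩ := hN q hq hqs p hp
    -- `C` and `D` compare the continuous seminorms on `X` and `K` with `q` and `p`; `q 1` is the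
    -- cost of evaluating operators at `1`.
    refine ⟨N, ⟨hNc, fun x y => ?_⟩, C * D * q 1, fun x => ?_⟩
    · refine hd.induction_on₂ (p := fun x y => N (M.smashMul x y) ≤ N x * N y) ?_
        (fun s t => ?_) x y
      · exact isClosed_le (hNc.comp (.smashMul M continuous_fst continuous_snd))
          ((hNc.comp continuous_fst).mul (hNc.comp continuous_snd))
      · obtain ⟨u, hu, hu'⟩ := exists_smashMul_ofMap hA M hD hM s t
        rw [hu, hN, hN, hN]
        exact smashSeminorm_le_mul hq hqs hp (hu' q hq hqs)
    · refine hd.induction_on (p := fun x => P x ≤ C * D * q 1 * N x) x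
        (isClosed_le hP (continuous_const.mul hNc)) fun u => ?_
      rw [hN, mul_assoc]
      exact (projSeminorm_bound hC hDn hqC hpD P h u).trans
        (mul_le_mul_of_nonneg_left (projSeminorm_le_smashSeminorm hA hq hqs p u) (by positivity))

end Smash

/-! ### The extensions for the Arens–Michael envelope and the `H`-completion -/

section CompletionSeminorm

open UniformSpace

/-- Continuous seminorms on a projective tensor product extend to the completed tensor product of
the completions. -/
theorem exists_seminorm_ctensor_completion {E F : Type*}
    [AddCommGroup E] [Module ℂ E] [UniformSpace E] [LCSpace E]
    [AddCommGroup F] [Module ℂ F] [UniformSpace F] [LCSpace F] (N : Seminorm ℂ (E ⊗[ℂ] F))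
    (hN : N ∈ projSeminorms E F) :
    ∃ N' : Seminorm ℂ (CTensor (Completion E) (Completion F)), Continuous N' ∧
      ∀ u, N' (ofMap (completionCoe E) (completionCoe F) u) = N u := by
  -- Extending `tmul` to the completions gives a map from the tensor product of the completions back
  -- to `CTensor E F`. Pulling the extension of `N` back along it avoids proving that the two
  -- completed tensor products are isomorphic.
  obtain ⟨T, hT, hTe⟩ := exists_bilinear_extension
    (tmul : E →ₗ[ℂ] F →ₗ[ℂ] CTensor E F) continuous_tmul
  have hNc : @Continuous (ProjTensor E F) ℝ _ _ N :=
    continuous_of_mem_seminormUniformity (S := projSeminorms E F) hN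
  let N₁ := completionSeminorm (E := ProjTensor E F) N hNc
  have h1 : ∀ u, lift T hT (ofMap (completionCoe E) (completionCoe F) u) = ofTensor u := by
    intro u
    induction u with
    | zero => simp
    | add s t hs ht => simp only [map_add, hs, ht]
    | tmul x y =>
      rw [ofMap_tmul, lift_tmul]
      exact hTe x y
  refine ⟨N₁.comp (lift T hT).toLinearMap,
    (continuous_completionSeminorm (E := ProjTensor E F) N hNc).comp (lift T hT).continuous, fun u => ?_⟩
  exact (congrArg N₁ (h1 u)).trans (completionSeminorm_coe (E := ProjTensor E F) N hNc u)

variable {H A : Type*} [Ring H] [Bialgebra ℂ H] [Ring A] [Algebra ℂ A] [Module H A]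
  [IsScalarTower ℂ H A]

theorem exists_smashSeminorm_extension {q : Seminorm ℂ A} (hq : IsSubmultiplicative q)
    (hs : IsStableSeminorm H q) {p : Seminorm ℂ H} (hp : IsSubmultiplicative p) :
    ∃ N : Seminorm ℂ (CTensor (HCompletion H A) (AMEnvelope H)), Continuous N ∧
      ∀ u, N (ofMap (HCompletion.ι H A).toLinearMap (AMEnvelope.ι H).toLinearMap u) =
        smashSeminorm hq hs p u := by
  have h1 := SeminormAlgebra.continuous_seminorm (A := H) (P := fun _ => True)
    (isSubmultiplicative_comulSeminorm
      (NormedBySeminorm.isSubmultiplicative_actionSeminorm hs) hp) trivial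
  have h2 := exists_seminorm_ctensor_completion (E := SeminormAlgebra A (IsStableSeminorm H))
    (F := SeminormAlgebra H fun _ => True)
  exact h2 (smashSeminorm (A := A) (H := H) hq hs p)
    -- The second seminorm is `comulSeminorm` of the operator seminorm and `p`; `h1` is its
    -- continuity.
    ⟨q, _, SeminormAlgebra.continuous_seminorm hq hs, h1, smashSeminorm_tmul_le hq hs p⟩

/-- The action of `H` on `A` extends to completions. -/
theorem exists_extendsAction (H A : Type*) [Ring H] [Bialgebra ℂ H] [Ring A] [Algebra ℂ A]
    [Module H A] [IsScalarTower ℂ H A] :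
    ∃ m : AMEnvelope H →ₗ[ℂ] HCompletion H A →ₗ[ℂ] HCompletion H A,
      (Continuous fun z : AMEnvelope H × HCompletion H A => m z.1 z.2) ∧ ExtendsAction m := by
  let B : H →ₗ[ℂ] A →ₗ[ℂ] HCompletion H A :=
    LinearMap.mk₂ ℂ (fun h a => HCompletion.ι H A (h • a))
      (fun h k a => by rw [add_smul, map_add]) (fun c h a => by rw [smul_assoc, map_smul])
      (fun h a b => by rw [smul_add, map_add]) (fun c h a => by rw [smul_orbit_comm, map_smul])
  let B' : SeminormAlgebra H (fun _ => True) →ₗ[ℂ] SeminormAlgebra A (IsStableSeminorm H) →ₗ[ℂ]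
    HCompletion H A := B
  refine exists_bilinear_extension B' (continuous_of_bounds _ fun P hP => ?_)
  obtain ⟨q, hq, hs, C, hC, h⟩ := HCompletion.exists_bound P hP
  have h1 : @Continuous (SeminormAlgebra H fun _ => True) ℝ _ _
      (NormedBySeminorm.actionSeminorm H hs) := SeminormAlgebra.continuous_seminorm
        (NormedBySeminorm.isSubmultiplicative_actionSeminorm hs) trivial
  have h2 : @Continuous (SeminormAlgebra A (IsStableSeminorm H)) ℝ _ _ q :=
    SeminormAlgebra.continuous_seminorm hq hs
  -- The bound must be a plain product of two seminorms, so the constant `C` is absorbed into the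
  -- one on `H`.
  refine ⟨C.toNNReal • NormedBySeminorm.actionSeminorm H hs, q, h1.const_smul C.toNNReal, h2,
    fun x y => (h _).trans ?_⟩
  change _ ≤ (C.toNNReal : ℝ) * NormedBySeminorm.actionSeminorm H hs x * q y
  rw [Real.coe_toNNReal _ hC, mul_assoc]
  exact mul_le_mul_of_nonneg_left (NormedBySeminorm.seminorm_smul_le hs x y) hC

theorem ExtendsAction.unique {H A : Type*} [Ring H] [Bialgebra ℂ H] [Ring A] [Algebra ℂ A]
    [Module H A] {m m' : AMEnvelope H →ₗ[ℂ] HCompletion H A →ₗ[ℂ] HCompletion H A}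
    (hc : Continuous fun z : AMEnvelope H × HCompletion H A => m z.1 z.2)
    (hc' : Continuous fun z : AMEnvelope H × HCompletion H A => m' z.1 z.2)
    (hm : ExtendsAction m) (hm' : ExtendsAction m') : m = m' := by
  refine LinearMap.ext₂ fun x y => ?_
  exact congrFun ((AMEnvelope.denseRange_ι.prodMap HCompletion.denseRange_ι).equalizer hc hc'
    (funext fun z => (hm z.1 z.2).trans (hm' z.1 z.2).symm)) (x, y)

theorem AMEnvelope.exists_hatBialgebra (H : Type*) [Ring H] [Bialgebra ℂ H] :
    ∃ B : HatBialgebra (AMEnvelope H), B.Extends := by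
  obtain ⟨D, hD⟩ := AMEnvelope.exists_extension (H := H)
    (ofMap (AMEnvelope.ι H).toLinearMap (AMEnvelope.ι H).toLinearMap ∘ₗ Coalgebra.comul)
    (exists_comul_bound (AMEnvelope.ι H) AMEnvelope.exists_bound)
  obtain ⟨e, he⟩ := AMEnvelope.exists_extension (H := H) Coalgebra.counit
    fun P _ => exists_counit_bound P
  obtain ⟨B, rfl, rfl⟩ := exists_hatBialgebra_of_dense AMEnvelope.denseRange_ι D hD e he
  exact ⟨B, hD, he⟩

end CompletionSeminorm

/-! ### The proposition -/

theorem mainTheorem3 (H A : Type*) [Ring H] [Bialgebra ℂ H] [Ring A] [Algebra ℂ A] [Module H A]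
    [IsScalarTower ℂ H A] (hA : IsModuleAlgebra H A) :
    ∃ B : HatBialgebra (AMEnvelope H),
      B.Extends ∧ (∀ B' : HatBialgebra (AMEnvelope H), B'.Extends → B' = B) ∧
      ∃ M : HatModuleAlgebra (HCompletion H A) B,
        ExtendsAction M.act ∧
        (∀ m : AMEnvelope H →ₗ[ℂ] HCompletion H A →ₗ[ℂ] HCompletion H A,
          (Continuous fun z : AMEnvelope H × HCompletion H A => m z.1 z.2) →
          ExtendsAction m → m = M.act) ∧
        IsArensMichael M.smashMul (CTensor.tmul 1 1) := by
  obtain ⟨B, hB⟩ := AMEnvelope.exists_hatBialgebra H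
  obtain ⟨m, hc, hm⟩ := exists_extendsAction H A
  obtain ⟨M, rfl⟩ := exists_hatModuleAlgebra_of_dense hA AMEnvelope.denseRange_ι
    HCompletion.denseRange_ι B hB.1 hB.2 m hc hm
  exact ⟨B, hB, fun B' hB' => HatBialgebra.eq_of_dense AMEnvelope.denseRange_ι
      (fun a => (hB'.1 a).trans (hB.1 a).symm) (fun a => (hB'.2 a).trans (hB.2 a).symm),
    M, hm, fun m' hc' hm' => hm'.unique hc' hc hm,
    isArensMichael_smashMul hA AMEnvelope.denseRange_ι HCompletion.denseRange_ι M hB.1 hm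
      AMEnvelope.exists_bound HCompletion.exists_bound
      fun _ hq hs _ hp => exists_smashSeminorm_extension hq hs hp⟩
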